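/- Let $G$ be a connected simple graph with $n>1$ nodes whose automorphism group acts transitively on the nodes, and let $r$ be a node. Let $M$ be the transition matrix of the simple random walk on $G$ and let $(w_t)_{t\ge 0}$, $w_0=r$, be the lazy random walk, with transition matrix $M'=\frac12(I+M)$. Let $1=\lambda_1\ge\lambda_2\ge\dots\ge\lambda_n$ be the eigenvalues of $M'$ with multiplicity, let $\tau=1-\lambda_2$ be the spectral gap, and let $q_m=P_m(r,r)-\frac1n$ with $P_m(r,r)=(M'^m)_{rr}$. An observer sees only the times $0=T_0<T_1<T_2<\cdots$ at which the lazy walk is at $r$. Let $0<\varepsilon<1$, $0<\delta<1$ and $c\ge 1+2/\varepsilon$. Put $K_0=(c+1)n^2\ln n$, $\eta=\varepsilon/(8n^c)$ and $N=\lceil \eta^{-2}\,\log_2(K_0)/\delta\rceil$. An experiment for $m$ starts at a return $T_i$ and observes the returns up to the first $T_j\ge T_i+m$ (with $j\ge i$); it succeeds if $T_j=T_i+m$. The estimate $Q_m$ of $q_m$ is the relative frequency of successes in $N$ consecutive experiments for $m$, minus $\frac1n$; each new estimate uses fresh experiments, started where the preceding one ended. The observer computes $Q_0$ and $Q_{\lfloor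 K_0\rfloor}$ and then runs a binary search on the integers of $[0,K_0]$: from an interval $[a,b]$ with $b-a\ge2$ he computes $Q_m$ for $m=\lfloor (a+b)/2\rfloor$ and passes to $[a,m]$ if $Q_m\le 1/n^c$ and to $[m,b]$ otherwise. Let $[k-1,k]$ be the final interval. Then: 1. Almost surely the walk returns to $r$ infinitely often, and $\mathsf E(T_1)=n$. 2. With probability at least $1-\delta$, we have $1\le k\le K_0$, $Q_k\le 1/n^c<Q_{k-1}$, $|q_k-Q_k|<\eta$, $|q_{k-1}-Q_{k-1}|<\eta$, and $$(1-\varepsilon)\,\tau\;\le\;1-Q_k^{1/k}\;\le\;(1+\varepsilon)\,\tau .$$ 3. Almost surely the whole computation depends only on the returns observed up to its end, and their number is at most $C\,n^{2c+3}\varepsilon^{-2}\delta^{-1}$, where $C$ depends only on $c$. So, for fixed $\varepsilon$ and $\delta$, the spectral gap is estimated up to a constant factor from polynomially many (in $n$) observed returns. -/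

import Mathlib

open MeasureTheory

namespace BatWalk

noncomputable section

/-! ### The graph, the lazy walk and its spectral gap -/

/-- The automorphism group of `G` acts transitively on the nodes. -/
def NodeTransitive {V : Type*} (G : SimpleGraph V) : Prop :=
  ∀ x y : V, ∃ φ : G ≃g G, φ x = y

/-- Transition matrix `M` of the simple random walk: a uniformly chosen neighbour. -/
def walkMatrix {V : Type*} [Fintype V] (G : SimpleGraph V) [DecidableRel G.Adj] :
    Matrix V V ℝ :=
  Matrix.of fun x y => if G.Adj x y then 1 / (G.degree x : ℝ) else 0

/-- Transition matrix `(1/2)(I + M)` of the lazy random walk. -/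
def lazyMatrix {V : Type*} [Fintype V] [DecidableEq V] (G : SimpleGraph V)
    [DecidableRel G.Adj] : Matrix V V ℝ :=
  (1 / 2 : ℝ) • (1 + walkMatrix G)

/-- The real eigenvalues of a matrix, repeated according to multiplicity, in decreasing order. -/
def eigenvalueList {V : Type*} [Fintype V] [DecidableEq V] (A : Matrix V V ℝ) : List ℝ :=
  A.charpoly.roots.sort (fun a b => a ≥ b)

/-- The spectral gap `τ = 1 - λ₂` of the lazy walk (`λ₁ = 1` has index `0` in the list). -/
def spectralGap {V : Type*} [Fintype V] [DecidableEq V] (G : SimpleGraph V)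
    [DecidableRel G.Adj] : ℝ :=
  1 - (eigenvalueList (lazyMatrix G)).getD 1 0

/-- `q_m = P_m(r,r) - 1/n`, where `P_m(r,r)` is the `m`-step return probability of the lazy
walk. -/
def excess {V : Type*} [Fintype V] [DecidableEq V] (G : SimpleGraph V)
    [DecidableRel G.Adj] (r : V) (m : ℕ) : ℝ :=
  (lazyMatrix G ^ m) r r - 1 / (Fintype.card V : ℝ)

/-- `w` is a lazy random walk on `G` started at `r`: the Markov chain with transition matrix
`lazyMatrix G` and initial state `r`, described by the law of its initial segments. -/
structure IsLazyWalk {V Ω : Type*} [Fintype V] [DecidableEq V] [MeasurableSpace Ω]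
    (G : SimpleGraph V) [DecidableRel G.Adj] (r : V) (μ : Measure Ω) (w : ℕ → Ω → V) :
    Prop where
  measurableSet_eq : ∀ (t : ℕ) (v : V), MeasurableSet {ω | w t ω = v}
  law : ∀ (t : ℕ) (x : ℕ → V),
    μ.real {ω | ∀ s ≤ t, w s ω = x s} =
      if x 0 = r then ∏ s ∈ Finset.range t, lazyMatrix G (x s) (x (s + 1)) else 0

/-- The return time sequence: `T 0 = 0` is the start and `T i` is the time of the `i`-th return
to `r` (provided that there are infinitely many returns). -/
def returnTime {V Ω : Type*} (w : ℕ → Ω → V) (r : V) (ω : Ω) (i : ℕ) : ℕ :=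
  Nat.nth (fun t => w t ω = r) i

/-! ### The observer's procedure

Everything below is a function of the return time sequence `T` (and of `n` and the parameters
`c`, `ε`, `δ`) alone. -/

/-- The experiment for `m` that begins at the `i`-th return ends at the first return whose time is
at least `T i + m`; this is the index of that return. -/
def experimentEnd (T : ℕ → ℕ) (m i : ℕ) : ℕ :=
  sInf {j | i ≤ j ∧ T i + m ≤ T j}

/-- Index of the return at which the `j`-th of a row of consecutive experiments for `m` begins,
when the first of them (`j = 0`) begins at the `i`-th return. -/
def experimentIndex (T : ℕ → ℕ) (m i j : ℕ) : ℕ :=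
  (experimentEnd T m)^[j] i

/-- The estimate `Q_m` of `q_m`: the relative frequency, among `N` consecutive experiments for `m`
beginning at the `i`-th return, of those that succeed (end exactly `m` time units after they
began), minus `1/n`. -/
def estimate (n N : ℕ) (T : ℕ → ℕ) (m i : ℕ) : ℝ :=
  (((Finset.range N).filter fun j =>
      T (experimentIndex T m i (j + 1)) = T (experimentIndex T m i j) + m).card : ℝ) / (N : ℝ)
    - 1 / (n : ℝ)

/-- State of the binary search: the current interval `[lo, hi]`, the estimates `Qlo`, `Qhi`
computed for its end points, and the number `used` of returns observed so far. -/
structure SearchState where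
  lo : ℕ
  hi : ℕ
  Qlo : ℝ
  Qhi : ℝ
  used : ℕ

/-- `K₀ = (c + 1) n² ln n`. -/
def searchBound (n : ℕ) (c : ℝ) : ℝ :=
  (c + 1) * (n : ℝ) ^ 2 * Real.log n

/-- The threshold `1 / n^c`. -/
def threshold (n : ℕ) (c : ℝ) : ℝ :=
  1 / (n : ℝ) ^ c

/-- The additive error `ε / (8 n^c)` admitted in each estimate. -/
def tolerance (n : ℕ) (c ε : ℝ) : ℝ :=
  ε / (8 * (n : ℝ) ^ c)

/-- Number of experiments spent on one estimate: `η⁻² δ'⁻¹`, rounded up, with additive error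
`η = ε / (8 n^c)` and failure probability `δ' = δ / log₂ K₀`. -/
def sampleSize (n : ℕ) (c ε δ : ℝ) : ℕ :=
  ⌈1 / (tolerance n c ε ^ 2 * (δ / Real.logb 2 (searchBound n c)))⌉₊

/-- The search starts with the integers of `[0, K₀]`, estimating at both end points. -/
def searchInit (n : ℕ) (c ε δ : ℝ) (T : ℕ → ℕ) : SearchState where
  lo := 0
  hi := ⌊searchBound n c⌋₊
  Qlo := estimate n (sampleSize n c ε δ) T 0 0
  Qhi := estimate n (sampleSize n c ε δ) T ⌊searchBound n c⌋₊
    (experimentIndex T 0 0 (sampleSize n c ε δ))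
  used := experimentIndex T ⌊searchBound n c⌋₊
    (experimentIndex T 0 0 (sampleSize n c ε δ)) (sampleSize n c ε δ)

/-- One halving: estimate `q_m` at the midpoint `m` from fresh experiments, and keep the half at
whose ends the estimates lie on the two sides of the threshold. Nothing is done once the interval
has length at most `1`. -/
def searchStep (n : ℕ) (c ε δ : ℝ) (T : ℕ → ℕ) (s : SearchState) : SearchState :=
  open Classical in
  if s.hi ≤ s.lo + 1 then s
  else if estimate n (sampleSize n c ε δ) T ((s.lo + s.hi) / 2) s.used ≤ threshold n c then
    { lo := s.lo
      hi := (s.lo + s.hi) / 2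
      Qlo := s.Qlo
      Qhi := estimate n (sampleSize n c ε δ) T ((s.lo + s.hi) / 2) s.used
      used := experimentIndex T ((s.lo + s.hi) / 2) s.used (sampleSize n c ε δ) }
  else
    { lo := (s.lo + s.hi) / 2
      hi := s.hi
      Qlo := estimate n (sampleSize n c ε δ) T ((s.lo + s.hi) / 2) s.used
      Qhi := s.Qhi
      used := experimentIndex T ((s.lo + s.hi) / 2) s.used (sampleSize n c ε δ) }

/-- The final state of the binary search; `⌈log₂ ⌊K₀⌋⌉` halvings bring the length of the interval
down to `1`. The value `k` that is found is the final `hi`, with `Q_k = Qhi` and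
`Q_{k-1} = Qlo`. -/
def binarySearch (n : ℕ) (c ε δ : ℝ) (T : ℕ → ℕ) : SearchState :=
  (searchStep n c ε δ T)^[Nat.clog 2 ⌊searchBound n c⌋₊] (searchInit n c ε δ T)

/-- The estimate `1 - Q_k^{1/k}` of the spectral gap. -/
def SearchState.gapEstimate (s : SearchState) : ℝ :=
  1 - s.Qhi ^ (1 / (s.hi : ℝ))

end

end BatWalk

set_option linter.unusedSectionVars false

namespace BatWalk

/-! ### Deterministic properties of the observer's procedure -/

/-! Write λ = 1 - τ and θ = n^(-c). By transitivity all diagonal entries of M'^m are equal, so n q_m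
is the sum of the m-th powers of the eigenvalues other than one copy of 1 (`excess_spectral`).
Laziness makes these nonnegative, whence λ^m / n ≤ q_m ≤ λ^m. The search looks for a k at which q
falls to about θ, and there the k-th root of the estimate is close to λ (`gap_accuracy`). From
above: λ^k is small, so kτ is bounded below by Bernoulli, and an error of order ε λ^(k-1) raises the
root by at most ετ. From below: λ^k is at most about n^(1-c) ≤ n^(-2/ε), so (λ^k)^ε is of order
n^(-2) and absorbs the lost factor 1/n, while q_(k-1) ≤ 4 q_k (Chebyshev's sum inequality) keeps the
sampling error from swallowing q_k.

That q is already below θ at K₀ rests on τ ≥ 1/n². The edge connectivity of a connected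
node-transitive graph is at least the degree (`degree_le_cut`); integrating over level sets and
applying Cauchy–Schwarz turns this into a Poincaré inequality (`poincare`).

Since the observer sees exactly the visits to r, the walk starts afresh at any return that he can
recognise (`IsLazyWalk.strong_markov`). So the successes in an estimate are binomial, even though m
is chosen adaptively, and Chebyshev's inequality with a union bound gives the failure probability δ.
Recurrence and the mean return time n come from a finite form of Kac's formula
(`sum_range_sum_avoidTo`) and a maximum principle (`tendsto_avoidFrom`). -/

theorem experimentEnd_spec {T : ℕ → ℕ} (hT : StrictMono T) (m i : ℕ) :
    i ≤ experimentEnd T m i ∧ T i + m ≤ T (experimentEnd T m i) := by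
  -- Strictly increasing integer times gain at least one per return, so `m` returns suffice; the
  -- infimum is therefore attained.
  have h : (i + m) ∈ {j | i ≤ j ∧ T i + m ≤ T j} := by
    refine ⟨Nat.le_add_right _ _, ?_⟩
    induction m with
    | zero => simp
    | succ m ih =>
      have := hT (show i + m < i + (m + 1) by omega)
      omega
  exact Nat.sInf_mem ⟨_, h⟩

theorem experimentEnd_le {T : ℕ → ℕ} (hT : StrictMono T) (m i : ℕ) :
    experimentEnd T m i ≤ i + m := by
  refine Nat.sInf_le ⟨Nat.le_add_right _ _, ?_⟩
  induction m with
  | zero => simp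
  | succ m ih =>
    have := hT (show i + m < i + (m + 1) by omega)
    omega

/-- Only `T` has to be increasing: the index found for `T` is admissible for `T'` as well, and any
smaller one lies where the two agree. -/
theorem experimentEnd_congr {T T' : ℕ → ℕ} (hT : StrictMono T) {m i : ℕ}
    (h : ∀ j ≤ experimentEnd T m i, T' j = T j) :
    experimentEnd T' m i = experimentEnd T m i := by
  obtain ⟨h1, h2⟩ := experimentEnd_spec hT m i
  have hmem : experimentEnd T m i ∈ {j | i ≤ j ∧ T' i + m ≤ T' j} := by
    refine ⟨h1, ?_⟩
    rw [h _ le_rfl, h _ h1]; exact h2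
  refine le_antisymm (Nat.sInf_le hmem) ?_
  have hs : experimentEnd T' m i ∈ {j | i ≤ j ∧ T' i + m ≤ T' j} := Nat.sInf_mem ⟨_, hmem⟩
  have hle : experimentEnd T' m i ≤ experimentEnd T m i := Nat.sInf_le hmem
  refine Nat.sInf_le ⟨hs.1, ?_⟩
  have := hs.2
  rwa [h _ hle, h _ h1] at this

theorem experimentIndex_succ (T : ℕ → ℕ) (m i j : ℕ) :
    experimentIndex T m i (j + 1) = experimentEnd T m (experimentIndex T m i j) :=
  Function.iterate_succ_apply' _ _ _

theorem experimentIndex_mono {T : ℕ → ℕ} (hT : StrictMono T) (m i : ℕ) :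
    Monotone (experimentIndex T m i) :=
  monotone_nat_of_le_succ fun j => by
    rw [experimentIndex_succ]; exact (experimentEnd_spec hT _ _).1

theorem le_experimentIndex {T : ℕ → ℕ} (hT : StrictMono T) (m i j : ℕ) :
    i ≤ experimentIndex T m i j :=
  experimentIndex_mono hT m i (Nat.zero_le j)

theorem experimentIndex_le {T : ℕ → ℕ} (hT : StrictMono T) (m i j : ℕ) :
    experimentIndex T m i j ≤ i + j * m := by
  induction j with
  | zero => simp [experimentIndex]
  | succ j ih =>
    rw [experimentIndex_succ]
    have := experimentEnd_le hT m (experimentIndex T m i j)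
    rw [Nat.succ_mul]; omega

theorem experimentIndex_congr {T T' : ℕ → ℕ} (hT : StrictMono T) {m i j : ℕ}
    (h : ∀ l ≤ experimentIndex T m i j, T' l = T l) :
    experimentIndex T' m i j = experimentIndex T m i j := by
  induction j with
  | zero => rfl
  | succ j ih =>
    have hj := experimentIndex_mono hT m i (Nat.le_succ j)
    rw [experimentIndex_succ, ih fun l hl => h l (hl.trans hj), experimentIndex_succ]
    refine experimentEnd_congr hT ?_
    rwa [← experimentIndex_succ]

/-- The number of successes among the first `N` experiments for `m` beginning at return `i`. -/
noncomputable def successCount (N : ℕ) (T : ℕ → ℕ) (m i : ℕ) : ℕ :=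
  ((Finset.range N).filter fun j =>
      T (experimentIndex T m i (j + 1)) = T (experimentIndex T m i j) + m).card

theorem estimate_eq (n N : ℕ) (T : ℕ → ℕ) (m i : ℕ) :
    estimate n N T m i = (successCount N T m i : ℝ) / N - 1 / n := rfl

theorem successCount_congr {T T' : ℕ → ℕ} (hT : StrictMono T) {N m i : ℕ}
    (h : ∀ l ≤ experimentIndex T m i N, T' l = T l) :
    successCount N T' m i = successCount N T m i := by
  unfold successCount
  congr 1
  refine Finset.filter_congr fun j hj => ?_
  have hj := Finset.mem_range.1 hj
  have h1 := experimentIndex_mono hT m i (show j ≤ N by omega)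
  have h2 := experimentIndex_mono hT m i (show j + 1 ≤ N by omega)
  rw [experimentIndex_congr hT fun l hl => h l (hl.trans h1),
    experimentIndex_congr hT fun l hl => h l (hl.trans h2), h _ h1, h _ h2]

theorem estimate_congr {T T' : ℕ → ℕ} (hT : StrictMono T) {n N m i : ℕ}
    (h : ∀ l ≤ experimentIndex T m i N, T' l = T l) :
    estimate n N T' m i = estimate n N T m i := by
  rw [estimate_eq, estimate_eq, successCount_congr hT h]

/-- The first experiment is split off rather than the last, because the walk will be restarted at
the end of the first. -/
theorem successCount_succ (N : ℕ) (T : ℕ → ℕ) (m i : ℕ) :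
    successCount (N + 1) T m i =
      successCount N T m (experimentEnd T m i) +
        if T (experimentEnd T m i) = T i + m then 1 else 0 := by
  unfold successCount
  rw [Finset.card_filter, Finset.card_filter, Finset.sum_range_succ']
  rfl

theorem experimentEnd_zero {T : ℕ → ℕ} (hT : StrictMono T) (i : ℕ) :
    experimentEnd T 0 i = i :=
  le_antisymm (by simpa using experimentEnd_le hT 0 i) (experimentEnd_spec hT 0 i).1

theorem experimentIndex_zero {T : ℕ → ℕ} (hT : StrictMono T) (i j : ℕ) :
    experimentIndex T 0 i j = i := by
  induction j with
  | zero => rfl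
  | succ j ih => rw [experimentIndex_succ, ih, experimentEnd_zero hT]

/-- An experiment for 0 ends where it begins and always succeeds, so Q₀ is exact and contributes
nothing to the failure probability. -/
theorem estimate_zero {T : ℕ → ℕ} (hT : StrictMono T) {n N : ℕ} (hN : 0 < N) (i : ℕ) :
    estimate n N T 0 i = 1 - 1 / (n : ℝ) := by
  have : successCount N T 0 i = N := by
    unfold successCount
    simp [experimentIndex_zero hT]
  rw [estimate_eq, this, div_self (by positivity)]

/-! ### Restarting the observation at a return -/

/-- The return times counted from the `i`-th return on. -/
def restart (T : ℕ → ℕ) (i : ℕ) : ℕ → ℕ := fun j => T (i + j) - T i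

theorem restart_add {T : ℕ → ℕ} (hT : StrictMono T) (i j : ℕ) :
    restart T i j + T i = T (i + j) :=
  Nat.sub_add_cancel (hT.monotone (Nat.le_add_right _ _))

theorem restart_strictMono {T : ℕ → ℕ} (hT : StrictMono T) (i : ℕ) :
    StrictMono (restart T i) := fun a b hab => by
  have := hT (show i + a < i + b by omega)
  have h1 := restart_add hT i a
  have h2 := restart_add hT i b
  omega

theorem experimentEnd_restart {T : ℕ → ℕ} (hT : StrictMono T) (m i j : ℕ) :
    i + experimentEnd (restart T i) m j = experimentEnd T m (i + j) := by
  have hS := restart_strictMono hT i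
  obtain ⟨h1, h2⟩ := experimentEnd_spec hS m j
  obtain ⟨h3, h4⟩ := experimentEnd_spec hT m (i + j)
  have key := restart_add hT i
  apply le_antisymm
  · obtain ⟨e, he⟩ := Nat.exists_eq_add_of_le (show i ≤ experimentEnd T m (i + j) by omega)
    rw [he] at h3 h4 ⊢
    have : experimentEnd (restart T i) m j ≤ e := by
      refine Nat.sInf_le ⟨by omega, ?_⟩
      have := key j; have := key e; omega
    omega
  · refine Nat.sInf_le ⟨by omega, ?_⟩
    have := key j; have := key (experimentEnd (restart T i) m j); omega

theorem experimentIndex_restart {T : ℕ → ℕ} (hT : StrictMono T) (m i l j : ℕ) :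
    i + experimentIndex (restart T i) m l j = experimentIndex T m (i + l) j := by
  induction j with
  | zero => rfl
  | succ j ih => rw [experimentIndex_succ, experimentIndex_succ, experimentEnd_restart hT, ih]

/-- Only differences of return times matter. This reduces estimates made in the middle of the search
to estimates made at time 0. -/
theorem successCount_restart {T : ℕ → ℕ} (hT : StrictMono T) (N m i : ℕ) :
    successCount N (restart T i) m 0 = successCount N T m i := by
  unfold successCount
  congr 1
  refine Finset.filter_congr fun j _ => ?_
  have h1 := experimentIndex_restart hT m i 0 j
  have h2 := experimentIndex_restart hT m i 0 (j + 1)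
  simp only [Nat.add_zero] at h1 h2
  rw [← h1, ← h2, ← restart_add hT, ← restart_add hT]
  omega

/-! ### The binary search -/

section search

variable (n : ℕ) (c ε δ : ℝ)

/-- The state of the search after `j` halvings. -/
noncomputable def searchAt (T : ℕ → ℕ) (j : ℕ) : SearchState :=
  (searchStep n c ε δ T)^[j] (searchInit n c ε δ T)

theorem searchAt_succ (T : ℕ → ℕ) (j : ℕ) :
    searchAt n c ε δ T (j + 1) = searchStep n c ε δ T (searchAt n c ε δ T j) :=
  Function.iterate_succ_apply' _ _ _

variable {T T' : ℕ → ℕ}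

theorem used_le_used_searchStep (hT : StrictMono T) (s : SearchState) :
    s.used ≤ (searchStep n c ε δ T s).used := by
  unfold searchStep
  split_ifs
  · rfl
  · exact le_experimentIndex hT _ _ _
  · exact le_experimentIndex hT _ _ _

theorem searchStep_congr (hT : StrictMono T) (s : SearchState)
    (h : ∀ i ≤ (searchStep n c ε δ T s).used, T' i = T i) :
    searchStep n c ε δ T' s = searchStep n c ε δ T s := by
  by_cases h1 : s.hi ≤ s.lo + 1
  · simp [searchStep, h1]
  · have hu : (searchStep n c ε δ T s).used =
        experimentIndex T ((s.lo + s.hi) / 2) s.used (sampleSize n c ε δ) := by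
      unfold searchStep
      rw [if_neg h1]
      split_ifs <;> rfl
    rw [hu] at h
    unfold searchStep
    rw [estimate_congr hT h, experimentIndex_congr hT h]

theorem searchInit_congr (hT : StrictMono T)
    (h : ∀ i ≤ (searchInit n c ε δ T).used, T' i = T i) :
    searchInit n c ε δ T' = searchInit n c ε δ T := by
  have h2 : ∀ i ≤ experimentIndex T 0 0 (sampleSize n c ε δ), T' i = T i := fun i hi =>
    h i (hi.trans (le_experimentIndex hT _ _ _))
  unfold searchInit at h ⊢
  rw [experimentIndex_congr hT h2, estimate_congr hT h2, estimate_congr hT h,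
    experimentIndex_congr hT h]

/-- The search depends only on the returns that it has observed. -/
theorem searchAt_congr (hT : StrictMono T) (j : ℕ)
    (h : ∀ i ≤ (searchAt n c ε δ T j).used, T' i = T i) :
    searchAt n c ε δ T' j = searchAt n c ε δ T j := by
  induction j with
  | zero => exact searchInit_congr n c ε δ hT h
  | succ j ih =>
    rw [searchAt_succ] at h ⊢
    rw [searchAt_succ, ih fun i hi => h i (hi.trans (used_le_used_searchStep n c ε δ hT _))]
    exact searchStep_congr n c ε δ hT _ h

theorem searchAt_bounds (T : ℕ → ℕ) (j : ℕ) :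
    (searchAt n c ε δ T j).lo ≤ (searchAt n c ε δ T j).hi ∧
      (searchAt n c ε δ T j).hi ≤ ⌊searchBound n c⌋₊ := by
  induction j with
  | zero => exact ⟨Nat.zero_le _, le_rfl⟩
  | succ j ih =>
    rw [searchAt_succ]
    unfold searchStep
    obtain ⟨h1, h2⟩ := ih
    split_ifs
    · exact ⟨h1, h2⟩
    · dsimp only; omega
    · dsimp only; omega

/-- An experiment for `m` consumes at most `m` returns, and `m` never exceeds ⌊K₀⌋. The 1 in `j + 1`
pays for the initial estimate at ⌊K₀⌋; the one at 0 is free. -/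
theorem used_searchAt_le (hT : StrictMono T) (j : ℕ) :
    (searchAt n c ε δ T j).used ≤ (j + 1) * (sampleSize n c ε δ * ⌊searchBound n c⌋₊) := by
  induction j with
  | zero =>
    have := experimentIndex_le hT ⌊searchBound n c⌋₊
      (experimentIndex T 0 0 (sampleSize n c ε δ)) (sampleSize n c ε δ)
    rw [experimentIndex_zero hT] at this
    simp only [zero_add, one_mul]
    simpa [searchAt, searchInit, experimentIndex_zero hT] using this
  | succ j ih =>
    rw [searchAt_succ]
    obtain ⟨h1, h2⟩ := searchAt_bounds n c ε δ T j
    set s := searchAt n c ε δ T j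
    have h3 := experimentIndex_le hT ((s.lo + s.hi) / 2) s.used (sampleSize n c ε δ)
    have h4 : sampleSize n c ε δ * ((s.lo + s.hi) / 2) ≤
        sampleSize n c ε δ * ⌊searchBound n c⌋₊ := Nat.mul_le_mul_left _ (by omega)
    rw [Nat.succ_mul]
    unfold searchStep
    split_ifs
    · exact ih.trans (Nat.le_add_right _ _)
    · dsimp only; omega
    · dsimp only; omega

end search

/-- If every estimate made is within `η` of the truth, the search ends with an interval of
length one that satisfies the invariants. -/
theorem searchAt_invariant {n : ℕ} {c ε δ : ℝ} {T : ℕ → ℕ} {q : ℕ → ℝ} {η : ℝ}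
    (hK : 1 ≤ ⌊searchBound n c⌋₊)
    (h0 : threshold n c < (searchInit n c ε δ T).Qlo)
    (h0' : |q 0 - (searchInit n c ε δ T).Qlo| < η)
    (h1 : (searchInit n c ε δ T).Qhi ≤ threshold n c)
    (h1' : |q ⌊searchBound n c⌋₊ - (searchInit n c ε δ T).Qhi| < η)
    {J : ℕ} (hstep : ∀ j < J, (searchAt n c ε δ T j).lo + 1 < (searchAt n c ε δ T j).hi →
      |q (((searchAt n c ε δ T j).lo + (searchAt n c ε δ T j).hi) / 2) -
        estimate n (sampleSize n c ε δ) T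
          (((searchAt n c ε δ T j).lo + (searchAt n c ε δ T j).hi) / 2)
          (searchAt n c ε δ T j).used| < η)
    {e : ℕ} (he : ⌊searchBound n c⌋₊ ≤ 2 ^ (J + e)) :
    ∀ s, s = searchAt n c ε δ T J →
      s.lo + 1 ≤ s.hi ∧ s.hi ≤ s.lo + 2 ^ e ∧ s.Qhi ≤ threshold n c ∧ threshold n c < s.Qlo ∧
        |q s.hi - s.Qhi| < η ∧ |q s.lo - s.Qlo| < η := by
  induction J generalizing e with
  | zero =>
    rintro s rfl
    refine ⟨by simpa [searchAt, searchInit] using hK, ?_, h1, h0, h1', h0'⟩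
    simpa [searchAt, searchInit] using he
  | succ J ih =>
    rintro s rfl
    -- The slack `e` counts the halvings still missing: one step earlier the interval may be twice
    -- as long.
    obtain ⟨a1, a2, a3, a4, a5, a6⟩ := ih (e := e + 1) (fun j hj => hstep j (by omega))
      (by rwa [show J + (e + 1) = J + 1 + e by ring]) _ rfl
    have hs := hstep J (by omega)
    rw [searchAt_succ]
    set s := searchAt n c ε δ T J
    have hpos : 1 ≤ 2 ^ e := Nat.one_le_two_pow
    rw [pow_succ] at a2
    unfold searchStep
    split_ifs with h2 h3
    · exact ⟨a1, by omega, a3, a4, a5, a6⟩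
    · refine ⟨?_, ?_, h3, a4, hs (by omega), a6⟩ <;> dsimp only <;> omega
    · refine ⟨?_, ?_, a3, not_le.1 h3, a5, hs (by omega)⟩ <;> dsimp only <;> omega

/-! ### Edge cuts of node-transitive graphs -/

section cut

variable {V : Type*} [Fintype V] [DecidableEq V] (G : SimpleGraph V) [DecidableRel G.Adj]

/-- The number of edges that leave `S`. -/
def cut (S : Finset V) : ℕ :=
  ∑ x, ∑ y, if x ∈ S ∧ y ∉ S ∧ G.Adj x y then 1 else 0

theorem cut_compl (S : Finset V) : cut G Sᶜ = cut G S := by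
  unfold cut
  rw [Finset.sum_comm]
  refine Finset.sum_congr rfl fun x _ => Finset.sum_congr rfl fun y _ => ?_
  simp only [Finset.mem_compl, not_not, G.adj_comm y x]
  congr 1
  simp only [eq_iff_iff]
  tauto

theorem cut_map (φ : G ≃g G) (S : Finset V) :
    cut G (S.map φ.toEquiv.toEmbedding) = cut G S := by
  unfold cut
  rw [← Equiv.sum_comp φ.toEquiv]
  refine Finset.sum_congr rfl fun x _ => ?_
  rw [← Equiv.sum_comp φ.toEquiv]
  refine Finset.sum_congr rfl fun y _ => ?_
  have h : ∀ z, φ.toEquiv z ∈ S.map φ.toEquiv.toEmbedding ↔ z ∈ S := fun z =>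
    Finset.mem_map' _
  simp only [h]
  congr 2
  simp only [eq_iff_iff]
  have : G.Adj (φ.toEquiv x) (φ.toEquiv y) ↔ G.Adj x y := φ.map_adj_iff
  rw [this]

/-- Submodularity holds separately for the contribution of each ordered pair of nodes. -/
theorem cut_inter_add_cut_union_le (S T : Finset V) :
    cut G (S ∩ T) + cut G (S ∪ T) ≤ cut G S + cut G T := by
  unfold cut
  rw [← Finset.sum_add_distrib, ← Finset.sum_add_distrib]
  refine Finset.sum_le_sum fun x _ => ?_
  rw [← Finset.sum_add_distrib, ← Finset.sum_add_distrib]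
  refine Finset.sum_le_sum fun y _ => ?_
  simp only [Finset.mem_inter, Finset.mem_union]
  by_cases h1 : x ∈ S <;> by_cases h2 : x ∈ T <;> by_cases h3 : y ∈ S <;> by_cases h4 : y ∈ T <;>
    by_cases h5 : G.Adj x y <;> simp [h1, h2, h3, h4, h5]

variable {G}

theorem cut_pos (hG : G.Connected) {S : Finset V} (hS : S.Nonempty) (hS' : S ≠ Finset.univ) :
    0 < cut G S := by
  by_contra h0
  have h0 : cut G S = 0 := by omega
  unfold cut at h0
  have hclosed : ∀ x y, G.Adj x y → x ∈ S → y ∈ S := by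
    intro x y hxy hx
    by_contra hy
    have := (Finset.sum_eq_zero_iff.1 h0) x (Finset.mem_univ _)
    have := (Finset.sum_eq_zero_iff.1 this) y (Finset.mem_univ _)
    simp [hx, hy, hxy] at this
  obtain ⟨a, ha⟩ := hS
  refine hS' (Finset.eq_univ_iff_forall.2 fun b => ?_)
  obtain ⟨p⟩ := hG.preconnected a b
  induction p with
  | nil => exact ha
  | cons h p ih => exact ih (hclosed _ _ h ha)

theorem NodeTransitive.degree_eq (hT : NodeTransitive G) (x y : V) :
    G.degree x = G.degree y := by
  obtain ⟨φ, rfl⟩ := hT x y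
  exact (φ.degree_eq x).symm

/-- In a connected node-transitive graph, no edge cut is smaller than the degree. -/
theorem degree_le_cut (hG : G.Connected) (hT : NodeTransitive G) {S : Finset V}
    (hS : S.Nonempty) (hS' : S ≠ Finset.univ) (v : V) : G.degree v ≤ cut G S := by
  classical
  set F : Finset (Finset V) :=
    Finset.univ.filter fun S : Finset V => S.Nonempty ∧ S ≠ Finset.univ with hF
  obtain ⟨S₀, hS₀, hmin⟩ := F.exists_min_image (cut G) ⟨S, by simp [hF, hS, hS']⟩
  -- An atom: a set of least cardinality among those with minimum cut.
  obtain ⟨A, hA, hAmin⟩ := (F.filter fun S => cut G S = cut G S₀).exists_min_image Finset.card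
    ⟨S₀, by simp [hS₀]⟩
  simp only [hF, Finset.mem_filter, Finset.mem_univ, true_and] at hA hmin hAmin
  obtain ⟨⟨hAne, hAuniv⟩, hAcut⟩ := hA
  refine le_trans ?_ (hmin S ⟨hS, hS'⟩)
  rw [← hAcut] at hmin hAmin ⊢
  -- The complement has the same cut, so an atom fills at most half of the nodes; this keeps the
  -- union of two overlapping translates proper.
  have hcompl : A.card ≤ Aᶜ.card := by
    refine hAmin _ ⟨⟨?_, ?_⟩, cut_compl G A⟩
    · rw [Finset.nonempty_iff_ne_empty, Ne, Finset.compl_eq_empty_iff]; exact hAuniv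
    · rw [Ne, Finset.compl_eq_univ_iff]; exact hAne.ne_empty
  have hn : A.card + Aᶜ.card = Fintype.card V := Finset.card_add_card_compl A
  -- If a translate met `A` without being `A`, submodularity would make the intersection a minimum
  -- cut too, with fewer nodes than the atom.
  have hatom : ∀ φ : G ≃g G, (A ∩ A.map φ.toEquiv.toEmbedding).Nonempty →
      A.map φ.toEquiv.toEmbedding = A := by
    intro φ hne
    by_contra hneq
    set B := A.map φ.toEquiv.toEmbedding with hB
    have hBcard : B.card = A.card := Finset.card_map _
    have hlt : (A ∩ B).card < A.card := by
      refine Finset.card_lt_card (Finset.ssubset_iff_subset_ne.2 ⟨Finset.inter_subset_left, ?_⟩)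
      intro h
      have hsub : A ⊆ B := Finset.inter_eq_left.1 h
      exact hneq (Finset.eq_of_subset_of_card_le hsub hBcard.le).symm
    have hcards := Finset.card_union_add_card_inter A B
    have hpos := hne.card_pos
    have hU : A ∪ B ≠ Finset.univ := by
      intro h
      have : (A ∪ B).card = Fintype.card V := by rw [h, Finset.card_univ]
      omega
    have hI : A ∩ B ≠ Finset.univ := by
      intro h
      have : (A ∩ B).card = Fintype.card V := by rw [h, Finset.card_univ]
      omega
    have h1 := hmin (A ∪ B) ⟨hAne.mono Finset.subset_union_left, hU⟩
    have h2 := hmin (A ∩ B) ⟨hne, hI⟩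
    have h3 := cut_inter_add_cut_union_le G A B
    have h4 : cut G B = cut G A := cut_map G φ A
    have h5 := hAmin (A ∩ B) ⟨⟨hne, hI⟩, by omega⟩
    omega
  set inner : V → ℕ := fun x => (A.filter fun y => G.Adj x y).card with hinner
  set outer : V → ℕ := fun x => ∑ y, if y ∉ A ∧ G.Adj x y then 1 else 0 with houter
  have hsum : ∀ x, inner x + outer x = G.degree x := by
    intro x
    have h1 : inner x = ∑ y, if y ∈ A ∧ G.Adj x y then 1 else 0 := by
      simp only [hinner]
      rw [← Finset.card_filter]
      congr 1
      ext y; simp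
    rw [h1, houter, ← Finset.sum_add_distrib, ← G.card_neighborFinset_eq_degree,
      ← Finset.filter_univ_mem (G.neighborFinset x), Finset.card_filter]
    refine Finset.sum_congr rfl fun y _ => ?_
    by_cases h2 : y ∈ A <;> by_cases h3 : G.Adj x y <;> simp [h2, h3]
  obtain ⟨a, ha⟩ := hAne
  -- An automorphism taking `a` to `x` maps the atom onto itself, so the graph induced on the atom
  -- is regular.
  have hconst : ∀ x ∈ A, inner x = inner a := by
    intro x hx
    obtain ⟨φ, hφ⟩ := hT a x
    have hφA := hatom φ ⟨x, by
      rw [Finset.mem_inter, Finset.mem_map]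
      exact ⟨hx, a, ha, hφ⟩⟩
    simp only [hinner]
    conv_lhs => rw [← hφA]
    rw [Finset.filter_map, Finset.card_map]
    congr 1
    refine Finset.filter_congr fun y _ => ?_
    simp only [Function.comp, Equiv.coe_toEmbedding]
    rw [← hφ]
    exact φ.map_adj_iff
  have hcutA : cut G A = A.card * outer a := by
    have : cut G A = ∑ x ∈ A, outer x := by
      unfold cut
      rw [← Finset.sum_subset (Finset.subset_univ A) fun x _ hx => by simp [hx]]
      exact Finset.sum_congr rfl fun x hx => by simp [hx, houter]
    rw [this, Finset.card_eq_sum_ones, Finset.sum_mul]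
    refine Finset.sum_congr rfl fun x hx => ?_
    have h1 := hsum x
    have h2 := hsum a
    have h3 := hconst x hx
    have h4 := hT.degree_eq x a
    omega
  have hcard : inner a + 1 ≤ A.card := by
    have : (A.filter fun y => G.Adj a y).card < A.card :=
      Finset.card_lt_card (Finset.filter_ssubset.2 ⟨a, ha, G.loopless.irrefl a⟩)
    exact this
  have hpos : 0 < cut G A := cut_pos hG ⟨a, ha⟩ hAuniv
  have hout : 1 ≤ outer a := by
    rw [hcutA] at hpos
    exact Nat.pos_of_mul_pos_left hpos
  rw [hcutA, hT.degree_eq v a, ← hsum a]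
  -- Since inner ≤ |A| - 1 and outer ≥ 1, the degree inner + outer is at most |A| · outer.
  nlinarith

end cut

/-! ### A Poincaré inequality -/

section poincare

variable {V : Type*} [Fintype V] [DecidableEq V] {G : SimpleGraph V} [DecidableRel G.Adj]

theorem integral_indicator_Ico_le (a b m M : ℝ) :
    ∫ t in m..M, (if b ≤ t ∧ t < a then (1 : ℝ) else 0) ≤ max (a - b) 0 := by
  rcases le_total M m with h | h
  · rw [intervalIntegral.integral_symm]
    have : 0 ≤ ∫ t in M..m, (if b ≤ t ∧ t < a then (1 : ℝ) else 0) :=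
      intervalIntegral.integral_nonneg h fun t _ => by split_ifs <;> norm_num
    have := le_max_right (a - b) 0
    linarith
  · rw [intervalIntegral.integral_of_le h]
    have heq : (fun t : ℝ => if b ≤ t ∧ t < a then (1 : ℝ) else 0) =
        (Set.Ico b a).indicator 1 := by
      ext t; simp [Set.indicator, Set.mem_Ico]
    rw [heq, integral_indicator_one measurableSet_Ico]
    calc (volume.restrict (Set.Ioc m M)).real (Set.Ico b a) ≤ volume.real (Set.Ico b a) := by
          apply ENNReal.toReal_mono (by simp)
          exact Measure.restrict_apply_le _ _
      _ = max (a - b) 0 := by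
          simp [Measure.real, Real.volume_Ico, ENNReal.toReal_ofReal']

/-- A coarea argument: for each level t between `f u` and `f v` the set {t < f} is nonempty and
proper, so at least `d` edges cross t. A single edge is crossed on a set of levels no longer than
its positive part; integrate over t. -/
theorem sum_cut_le {d : ℕ} (hcut : ∀ S : Finset V, S.Nonempty → S ≠ Finset.univ → d ≤ cut G S)
    (f : V → ℝ) (u v : V) (hu : ∀ x, f u ≤ f x) :
    d * (f v - f u) ≤ ∑ x, ∑ y, if G.Adj x y then max (f x - f y) 0 else 0 := by
  have hint : ∀ x y, IntervalIntegrable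
      (fun t : ℝ => if f y ≤ t ∧ t < f x then (1 : ℝ) else 0) volume (f u) (f v) := by
    intro x y
    have heq : (fun t : ℝ => if f y ≤ t ∧ t < f x then (1 : ℝ) else 0) =
        (Set.Ico (f y) (f x)).indicator 1 := by
      ext t; simp [Set.indicator, Set.mem_Ico]
    rw [heq]
    rw [intervalIntegrable_iff]
    exact (integrableOn_const (by simp) (by simp)).indicator measurableSet_Ico
  have hint' : ∀ x y, IntervalIntegrable (fun t : ℝ => if G.Adj x y then
      (if f y ≤ t ∧ t < f x then (1 : ℝ) else 0) else 0) volume (f u) (f v) := by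
    intro x y
    by_cases h : G.Adj x y
    · simpa [h] using hint x y
    · simp [h]
  have hint2 : ∀ x, IntervalIntegrable (fun t : ℝ => ∑ y, if G.Adj x y then
      (if f y ≤ t ∧ t < f x then (1 : ℝ) else 0) else 0) volume (f u) (f v) := fun x => by
    simpa only [Finset.sum_fn] using
      IntervalIntegrable.sum Finset.univ fun y _ => hint' x y
  have hlevel : ∀ t ∈ Set.Ico (f u) (f v), (d : ℝ) ≤
      ∑ x, ∑ y, if G.Adj x y then (if f y ≤ t ∧ t < f x then (1 : ℝ) else 0) else 0 := by
    intro t ht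
    have := hcut (Finset.univ.filter fun x => t < f x) ⟨v, by simpa using ht.2⟩ (by
      intro h
      have : u ∈ Finset.univ.filter fun x => t < f x := by rw [h]; simp
      simp only [Finset.mem_filter] at this
      exact absurd this.2 (not_lt.2 ht.1))
    refine le_trans (Nat.cast_le.2 this) (le_of_eq ?_)
    unfold cut
    push_cast
    refine Finset.sum_congr rfl fun x _ => Finset.sum_congr rfl fun y _ => ?_
    by_cases h : G.Adj x y <;> by_cases h1 : t < f x <;> by_cases h2 : f y ≤ t <;>
      simp [h, h1, h2, not_lt.2, not_le.1]
  have huv : f u ≤ f v := hu v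
  have h1 : (d : ℝ) * (f v - f u) = ∫ _ in (f u)..(f v), (d : ℝ) := by
    simp [mul_comm]
  rw [h1]
  have h2 : ∫ _ in (f u)..(f v), (d : ℝ) ≤ ∫ t in (f u)..(f v),
      ∑ x, ∑ y, if G.Adj x y then (if f y ≤ t ∧ t < f x then (1 : ℝ) else 0) else 0 := by
    refine intervalIntegral.integral_mono_on_of_le_Ioo huv (by simp) ?_ ?_
    · simpa only [Finset.sum_fn] using IntervalIntegrable.sum _ fun x _ => hint2 x
    · intro t ht
      exact hlevel t ⟨ht.1.le, ht.2⟩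
  refine h2.trans ?_
  rw [intervalIntegral.integral_finsetSum fun x _ => hint2 x]
  refine Finset.sum_le_sum fun x _ => ?_
  rw [intervalIntegral.integral_finsetSum fun y _ => hint' x y]
  refine Finset.sum_le_sum fun y _ => ?_
  by_cases h : G.Adj x y
  · simpa [h] using integral_indicator_Ico_le (f x) (f y) (f u) (f v)
  · simp [h]

/-- The sum of `(f x - f y)²` over all ordered pairs of adjacent nodes. -/
noncomputable def energy (G : SimpleGraph V) [DecidableRel G.Adj] (f : V → ℝ) : ℝ :=
  ∑ x, ∑ y, if G.Adj x y then (f x - f y) ^ 2 else 0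

theorem sum_adj_one_eq {d : ℕ} (hd : ∀ x, G.degree x = d) :
    (∑ x : V, ∑ y, if G.Adj x y then (1 : ℝ) else 0) = Fintype.card V * d := by
  have : ∀ x : V, (∑ y, if G.Adj x y then (1 : ℝ) else 0) = d := by
    intro x
    rw [← hd x, ← G.card_neighborFinset_eq_degree, Finset.sum_boole]
    congr 2
    ext y; simp
  simp [this]

/-- Let D be the oscillation of `f`. The cut bound gives 2dD ≤ ∑ |f x - f y|, and Cauchy–Schwarz
over the nd ordered adjacent pairs gives 4dD² ≤ n · energy. A function with mean zero takes values
within D of 0, so ∑ f² ≤ nD². -/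
theorem poincare {d : ℕ} (hd : ∀ x, G.degree x = d) (hd0 : 0 < d)
    (hcut : ∀ S : Finset V, S.Nonempty → S ≠ Finset.univ → d ≤ cut G S)
    [Nonempty V] (f : V → ℝ) (hf : ∑ x, f x = 0) :
    4 * d * ∑ x, f x ^ 2 ≤ (Fintype.card V : ℝ) ^ 2 * energy G f := by
  obtain ⟨u, -, hu⟩ := Finset.exists_min_image Finset.univ f Finset.univ_nonempty
  obtain ⟨v, -, hv⟩ := Finset.exists_max_image Finset.univ f Finset.univ_nonempty
  have hu := fun x => hu x (Finset.mem_univ x)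
  have hv := fun x => hv x (Finset.mem_univ x)
  have hn : (0 : ℝ) < Fintype.card V := by exact_mod_cast Fintype.card_pos
  have hu0 : f u ≤ 0 := by
    have : ∑ _x : V, f u ≤ ∑ x, f x := Finset.sum_le_sum fun x _ => hu x
    rw [hf] at this
    simp at this
    by_contra h
    nlinarith
  have hv0 : 0 ≤ f v := by
    have : ∑ x, f x ≤ ∑ _x : V, f v := Finset.sum_le_sum fun x _ => hv x
    rw [hf] at this
    simp at this
    by_contra h
    nlinarith
  have hsq : ∑ x, f x ^ 2 ≤ Fintype.card V * (f v - f u) ^ 2 := by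
    have : ∑ x, f x ^ 2 ≤ ∑ _x : V, (f v - f u) ^ 2 := Finset.sum_le_sum fun x _ => by
      apply sq_le_sq'
      · linarith [hu x]
      · linarith [hv x]
    simpa using this
  have habs : 2 * (d * (f v - f u)) ≤ ∑ x, ∑ y, if G.Adj x y then |f x - f y| else 0 := by
    have h1 := sum_cut_le hcut f u v hu
    have h2 : (∑ x, ∑ y, if G.Adj x y then |f x - f y| else 0) =
        2 * ∑ x, ∑ y, if G.Adj x y then max (f x - f y) 0 else 0 := by
      have hsw : (∑ x, ∑ y, if G.Adj x y then max (f x - f y) 0 else 0) =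
          ∑ x, ∑ y, if G.Adj x y then max (f y - f x) 0 else 0 := by
        rw [Finset.sum_comm]
        simp only [G.adj_comm]
      rw [two_mul]
      nth_rewrite 2 [hsw]
      rw [← Finset.sum_add_distrib]
      refine Finset.sum_congr rfl fun x _ => ?_
      rw [← Finset.sum_add_distrib]
      refine Finset.sum_congr rfl fun y _ => ?_
      split_ifs
      · rcases le_total (f x) (f y) with h | h
        · rw [abs_of_nonpos (by linarith), max_eq_right (by linarith), max_eq_left (by linarith)]
          ring
        · rw [abs_of_nonneg (by linarith), max_eq_left (by linarith), max_eq_right (by linarith)]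
          ring
      · ring
    rw [h2]; linarith
  have hcs : (∑ x, ∑ y, if G.Adj x y then |f x - f y| else 0) ^ 2 ≤
      (Fintype.card V * d) * energy G f := by
    have := Finset.sum_mul_sq_le_sq_mul_sq (Finset.univ : Finset (V × V))
      (fun p => if G.Adj p.1 p.2 then (1 : ℝ) else 0)
      (fun p => if G.Adj p.1 p.2 then |f p.1 - f p.2| else 0)
    rw [← sum_adj_one_eq hd, energy]
    have e1 : ∀ p : V × V, ((if G.Adj p.1 p.2 then (1 : ℝ) else 0) *
        if G.Adj p.1 p.2 then |f p.1 - f p.2| else 0) =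
        if G.Adj p.1 p.2 then |f p.1 - f p.2| else 0 := fun p => by split_ifs <;> simp
    have e2 : ∀ p : V × V, (if G.Adj p.1 p.2 then (1 : ℝ) else 0) ^ 2 =
        if G.Adj p.1 p.2 then 1 else 0 := fun p => by split_ifs <;> simp
    have e3 : ∀ p : V × V, (if G.Adj p.1 p.2 then |f p.1 - f p.2| else 0) ^ 2 =
        if G.Adj p.1 p.2 then (f p.1 - f p.2) ^ 2 else 0 := fun p => by split_ifs <;> simp
    simp only [e1, e2, e3, Fintype.sum_prod_type] at this
    exact this
  have hd0' : (0 : ℝ) < d := by exact_mod_cast hd0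
  have h4 : (2 * (d * (f v - f u))) ^ 2 ≤ (Fintype.card V * d) * energy G f :=
    (pow_le_pow_left₀ (by nlinarith) habs 2).trans hcs
  have h5 : 4 * d * (f v - f u) ^ 2 ≤ Fintype.card V * energy G f := by
    have : (d : ℝ) * (4 * d * (f v - f u) ^ 2) ≤ d * (Fintype.card V * energy G f) := by
      nlinarith
    exact le_of_mul_le_mul_left this hd0'
  calc 4 * d * ∑ x, f x ^ 2 ≤ 4 * d * (Fintype.card V * (f v - f u) ^ 2) := by gcongr
    _ = Fintype.card V * (4 * d * (f v - f u) ^ 2) := by ring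
    _ ≤ Fintype.card V * (Fintype.card V * energy G f) := by gcongr
    _ = _ := by ring

end poincare

open Matrix

/-! ### Eigenbases of real symmetric matrices -/

section spectral

variable {V : Type*} [Fintype V] [DecidableEq V]

theorem pow_eq_conj_pow {A U D W : Matrix V V ℝ} (h : A = U * D * W) (h1 : W * U = 1)
    (h2 : U * W = 1) (m : ℕ) : A ^ m = U * D ^ m * W := by
  induction m with
  | zero => simp [h2]
  | succ m ih =>
    rw [pow_succ, ih, h, pow_succ]
    calc U * D ^ m * W * (U * D * W) = U * D ^ m * (W * U) * D * W := by simp only [mul_assoc]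
      _ = U * (D ^ m * D) * W := by rw [h1]; simp only [mul_assoc, one_mul]

/-- An orthonormal eigenbasis of a real symmetric matrix, in which the two largest eigenvalues are
singled out. -/
theorem exists_sorted_eigenbasis {A : Matrix V V ℝ} (hA : A.IsHermitian)
    (hn : 1 < Fintype.card V) :
    ∃ (e : V → ℝ) (b : V → V → ℝ) (i₀ i₁ : V), i₀ ≠ i₁ ∧ (∀ i, e i ≤ e i₀) ∧
      (∀ i, i ≠ i₀ → e i ≤ e i₁) ∧ (eigenvalueList A).getD 1 0 = e i₁ ∧
      (∀ i, A *ᵥ b i = e i • b i) ∧ (∀ i j, b i ⬝ᵥ b j = if i = j then 1 else 0) ∧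
      (∀ v, (∀ i, b i ⬝ᵥ v = 0) → v = 0) ∧ (∀ m, (A ^ m).trace = ∑ i, e i ^ m) := by
  set σ : Fin (Fintype.card V) ≃ V := Fintype.equivOfCardEq (Fintype.card_fin _) with hσ
  have hev : ∀ j, hA.eigenvalues (σ j) = hA.eigenvalues₀ j := fun j => by
    unfold Matrix.IsHermitian.eigenvalues
    rw [← hσ, Equiv.symm_apply_apply]
  have hdot : ∀ (i : V) (v : V → ℝ), (hA.eigenvectorBasis i : V → ℝ) ⬝ᵥ v =
      inner ℝ (hA.eigenvectorBasis i) (WithLp.toLp 2 v) := fun i v => by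
    rw [EuclideanSpace.inner_eq_star_dotProduct]
    simp [dotProduct_comm]
  refine ⟨hA.eigenvalues, fun i => hA.eigenvectorBasis i, σ ⟨0, by omega⟩, σ ⟨1, hn⟩, ?_, ?_, ?_,
    ?_, ?_, ?_, ?_, ?_⟩
  · rw [Ne, σ.injective.eq_iff]; simp
  · intro i
    obtain ⟨j, rfl⟩ := σ.surjective i
    rw [hev, hev]
    exact hA.eigenvalues₀_antitone (Fin.mk_le_of_le_val (Nat.zero_le _))
  · intro i hi
    obtain ⟨j, rfl⟩ := σ.surjective i
    rw [hev, hev]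
    refine hA.eigenvalues₀_antitone (Fin.mk_le_of_le_val ?_)
    rw [Ne, σ.injective.eq_iff, Fin.ext_iff] at hi
    exact Nat.one_le_iff_ne_zero.2 hi
  · rw [hev]
    have h := hA.sort_roots_charpoly_eq_eigenvalues₀
    have : eigenvalueList A = List.ofFn hA.eigenvalues₀ := by
      rw [← h]
      unfold eigenvalueList
      congr 1
      simp
    rw [this, List.getD_eq_getElem _ _ (by simpa using hn), List.getElem_ofFn]
  · exact fun i => hA.mulVec_eigenvectorBasis i
  · intro i j
    rw [hdot]
    exact orthonormal_iff_ite.1 hA.eigenvectorBasis.orthonormal i j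
  · intro v hv
    have : WithLp.toLp 2 v = (0 : EuclideanSpace ℝ V) := by
      rw [← hA.eigenvectorBasis.sum_repr' (WithLp.toLp 2 v)]
      refine Finset.sum_eq_zero fun i _ => ?_
      rw [← hdot, hv, zero_smul]
    simpa using congrArg WithLp.ofLp this
  · intro m
    have h := hA.spectral_theorem
    rw [Unitary.conjStarAlgAut_apply] at h
    have hpow := pow_eq_conj_pow h (Unitary.coe_star_mul_self _) (Unitary.coe_mul_star_self _) m
    have hd : diagonal (RCLike.ofReal ∘ hA.eigenvalues) =
        (diagonal hA.eigenvalues : Matrix V V ℝ) := rfl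
    have hu : star (hA.eigenvectorUnitary : Matrix V V ℝ) *
          (hA.eigenvectorUnitary : Matrix V V ℝ) = 1 := Unitary.coe_star_mul_self _
    rw [hpow, hd, Matrix.trace_mul_comm, ← mul_assoc, hu, one_mul, diagonal_pow, trace_diagonal]
    simp

end spectral

/-! ### The lazy transition matrix and its spectrum -/

section lazy

variable {V : Type*} [Fintype V] [DecidableEq V] {G : SimpleGraph V} [DecidableRel G.Adj]
  {d : ℕ}

theorem lazyMatrix_apply (x y : V) : lazyMatrix G x y =
    1 / 2 * ((if x = y then 1 else 0) + if G.Adj x y then 1 / (G.degree x : ℝ) else 0) := by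
  simp [lazyMatrix, walkMatrix, Matrix.one_apply]

theorem lazyMatrix_nonneg (x y : V) : 0 ≤ lazyMatrix G x y := by
  rw [lazyMatrix_apply]
  split_ifs <;> positivity

theorem lazyMatrix_symm (hd : ∀ x, G.degree x = d) (x y : V) :
    lazyMatrix G x y = lazyMatrix G y x := by
  rw [lazyMatrix_apply, lazyMatrix_apply, hd, hd]
  simp only [G.adj_comm x y, eq_comm (a := x)]

theorem lazyMatrix_isHermitian (hd : ∀ x, G.degree x = d) : (lazyMatrix G).IsHermitian :=
  Matrix.IsHermitian.ext fun x y => by simpa using lazyMatrix_symm hd y x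

theorem sum_adj_right (hd : ∀ x, G.degree x = d) (x : V) (a : ℝ) :
    (∑ y, if G.Adj x y then a else 0) = d * a := by
  rw [← hd x, ← G.card_neighborFinset_eq_degree, ← Finset.sum_filter, Finset.sum_const,
    nsmul_eq_mul]
  congr 3
  ext y; simp

theorem lazyMatrix_row_sum (hd : ∀ x, G.degree x = d) (hd0 : 0 < d) (x : V) :
    ∑ y, lazyMatrix G x y = 1 := by
  have : (d : ℝ) ≠ 0 := by positivity
  simp only [lazyMatrix_apply]
  rw [← Finset.mul_sum, Finset.sum_add_distrib, hd, sum_adj_right hd]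
  simp
  field_simp
  norm_num

theorem lazyMatrix_mulVec_one (hd : ∀ x, G.degree x = d) (hd0 : 0 < d) :
    lazyMatrix G *ᵥ (fun _ => 1) = fun _ => 1 := by
  ext x
  simp [Matrix.mulVec, dotProduct, lazyMatrix_row_sum hd hd0]

theorem dotProduct_lazyMatrix_mulVec (hd : ∀ x, G.degree x = d) (hd0 : 0 < d) (f : V → ℝ) :
    f ⬝ᵥ (lazyMatrix G *ᵥ f) = 1 / 2 * ∑ x, f x ^ 2 +
      1 / (2 * d) * ∑ x, ∑ y, if G.Adj x y then f x * f y else 0 := by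
  simp only [Matrix.mulVec, dotProduct]
  rw [Finset.mul_sum, Finset.mul_sum, ← Finset.sum_add_distrib]
  refine Finset.sum_congr rfl fun x _ => ?_
  simp only [lazyMatrix_apply, hd]
  have h1 : ∀ y, 1 / 2 * ((if x = y then 1 else 0) + if G.Adj x y then 1 / (d : ℝ) else 0) * f y =
      1 / 2 * (if x = y then f y else 0) + 1 / (2 * d) * (if G.Adj x y then f y else 0) := by
    intro y
    split_ifs <;> field_simp <;> ring
  simp only [h1]
  rw [Finset.sum_add_distrib, ← Finset.mul_sum, ← Finset.mul_sum, Finset.sum_ite_eq]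
  simp only [Finset.mem_univ, if_true]
  rw [mul_add]
  congr 1
  · ring
  · rw [mul_left_comm, Finset.mul_sum]
    simp only [mul_ite, mul_zero]

theorem sum_adj_sq_left (hd : ∀ x, G.degree x = d) (f : V → ℝ) :
    (∑ x, ∑ y, if G.Adj x y then f x ^ 2 else 0) = d * ∑ x, f x ^ 2 := by
  rw [Finset.mul_sum]
  exact Finset.sum_congr rfl fun x _ => sum_adj_right hd x _

theorem sum_adj_sq_right (hd : ∀ x, G.degree x = d) (f : V → ℝ) :
    (∑ x, ∑ y, if G.Adj x y then f y ^ 2 else 0) = d * ∑ x, f x ^ 2 := by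
  rw [Finset.sum_comm, ← sum_adj_sq_left hd]
  simp only [G.adj_comm]

theorem energy_eq (hd : ∀ x, G.degree x = d) (f : V → ℝ) :
    energy G f = 2 * d * ∑ x, f x ^ 2 - 2 * ∑ x, ∑ y, if G.Adj x y then f x * f y else 0 := by
  have h : energy G f = (∑ x, ∑ y, if G.Adj x y then f x ^ 2 else 0) +
      (∑ x, ∑ y, if G.Adj x y then f y ^ 2 else 0) -
      2 * ∑ x, ∑ y, if G.Adj x y then f x * f y else 0 := by
    unfold energy
    simp only [Finset.mul_sum, ← Finset.sum_add_distrib, ← Finset.sum_sub_distrib]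
    refine Finset.sum_congr rfl fun x _ => Finset.sum_congr rfl fun y _ => ?_
    split_ifs <;> ring
  rw [h, sum_adj_sq_left hd, sum_adj_sq_right hd]
  ring

theorem energy_nonneg (f : V → ℝ) : 0 ≤ energy G f :=
  Finset.sum_nonneg fun x _ => Finset.sum_nonneg fun y _ => by split_ifs <;> positivity

theorem dotProduct_lazyMatrix_eq (hd : ∀ x, G.degree x = d) (hd0 : 0 < d) (f : V → ℝ) :
    f ⬝ᵥ (lazyMatrix G *ᵥ f) = ∑ x, f x ^ 2 - 1 / (4 * d) * energy G f := by
  have : (d : ℝ) ≠ 0 := by positivity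
  rw [dotProduct_lazyMatrix_mulVec hd hd0, energy_eq hd]
  field_simp
  ring

/-- Laziness makes the form a sum of squares: it equals 1/(4d) times the sum of (f x + f y)² over
ordered adjacent pairs. -/
theorem dotProduct_lazyMatrix_nonneg (hd : ∀ x, G.degree x = d) (hd0 : 0 < d) (f : V → ℝ) :
    0 ≤ f ⬝ᵥ (lazyMatrix G *ᵥ f) := by
  have hd' : (0 : ℝ) < d := by positivity
  have h : (0 : ℝ) ≤ ∑ x, ∑ y, if G.Adj x y then (f x + f y) ^ 2 else 0 :=
    Finset.sum_nonneg fun x _ => Finset.sum_nonneg fun y _ => by split_ifs <;> positivity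
  have h' : (∑ x, ∑ y, if G.Adj x y then (f x + f y) ^ 2 else 0) =
      (∑ x, ∑ y, if G.Adj x y then f x ^ 2 else 0) +
      (∑ x, ∑ y, if G.Adj x y then f y ^ 2 else 0) +
      2 * ∑ x, ∑ y, if G.Adj x y then f x * f y else 0 := by
    simp only [Finset.mul_sum, ← Finset.sum_add_distrib]
    refine Finset.sum_congr rfl fun x _ => Finset.sum_congr rfl fun y _ => ?_
    split_ifs <;> ring
  rw [h', sum_adj_sq_left hd, sum_adj_sq_right hd] at h
  rw [dotProduct_lazyMatrix_mulVec hd hd0]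
  have : 1 / 2 * ∑ x, f x ^ 2 + 1 / (2 * d) * (∑ x, ∑ y, if G.Adj x y then f x * f y else 0) =
      1 / (4 * d) * (d * ∑ x, f x ^ 2 + d * ∑ x, f x ^ 2 +
        2 * ∑ x, ∑ y, if G.Adj x y then f x * f y else 0) := by
    field_simp; ring
  rw [this]
  positivity

theorem lazyMatrix_map (φ : G ≃g G) (x y : V) :
    lazyMatrix G (φ x) (φ y) = lazyMatrix G x y := by
  simp only [lazyMatrix_apply, φ.degree_eq, φ.map_adj_iff, φ.injective.eq_iff]

theorem lazyMatrix_pow_map (φ : G ≃g G) (m : ℕ) (x y : V) :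
    (lazyMatrix G ^ m) (φ x) (φ y) = (lazyMatrix G ^ m) x y := by
  induction m generalizing x y with
  | zero => simp [Matrix.one_apply]
  | succ m ih =>
    rw [pow_succ, Matrix.mul_apply, Matrix.mul_apply, ← Equiv.sum_comp φ.toEquiv]
    refine Finset.sum_congr rfl fun z _ => ?_
    exact congrArg₂ _ (ih x z) (lazyMatrix_map φ z y)

/-- The spectral description of the return probabilities of the lazy walk. -/
theorem excess_spectral (hG : G.Connected) (hT : NodeTransitive G) (hn : 1 < Fintype.card V)
    (r : V) :
    ∃ (s : Finset V) (e : V → ℝ), (s.card : ℝ) = Fintype.card V - 1 ∧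
      (∀ m, (Fintype.card V : ℝ) * excess G r m = ∑ i ∈ s, e i ^ m) ∧
      (∀ i ∈ s, 0 ≤ e i ∧ e i ≤ 1 - spectralGap G) ∧ (∃ i ∈ s, e i = 1 - spectralGap G) ∧
      1 ≤ (Fintype.card V : ℝ) ^ 2 * spectralGap G := by
  have hd : ∀ x, G.degree x = G.degree r := fun x => hT.degree_eq x r
  have hd0 : 0 < G.degree r := by
    have : Nontrivial V := Fintype.one_lt_card_iff_nontrivial.1 hn
    exact hG.preconnected.degree_pos_of_nontrivial r
  have hd' : (0 : ℝ) < G.degree r := by exact_mod_cast hd0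
  have hn0 : (0 : ℝ) < Fintype.card V := by exact_mod_cast (by omega : 0 < Fintype.card V)
  obtain ⟨e, b, i₀, i₁, hne, hmax, hmax', hlist, hb, horth, hcomp, htr⟩ :=
    exists_sorted_eigenbasis (lazyMatrix_isHermitian hd) hn
  have hgap : 1 - spectralGap G = e i₁ := by rw [spectralGap, hlist]; ring
  have hself : ∀ i, ∑ x, b i x ^ 2 = 1 := fun i => by
    have := horth i i
    simpa [dotProduct, sq] using this
  have hquad : ∀ i, b i ⬝ᵥ (lazyMatrix G *ᵥ b i) = e i := fun i => by
    rw [hb, dotProduct_smul, horth]; simp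
  have he1 : ∀ i, e i ≤ 1 := fun i => by
    rw [← hquad, dotProduct_lazyMatrix_eq hd hd0, hself]
    have := energy_nonneg (G := G) (b i)
    have : 0 ≤ 1 / (4 * (G.degree r : ℝ)) * energy G (b i) := by positivity
    linarith
  have he0 : ∀ i, 0 ≤ e i := fun i => by
    rw [← hquad]; exact dotProduct_lazyMatrix_nonneg hd hd0 _
  -- If no eigenvalue were 1, symmetry would make every eigenvector orthogonal to the constants, and
  -- completeness would make the constants vanish.
  have hi₀ : e i₀ = 1 := by
    by_contra h
    have hlt : ∀ i, e i ≠ 1 := fun i hi => h (le_antisymm (he1 _) (hi ▸ hmax i))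
    have := hcomp (fun _ => 1) fun i => by
      have h1 : (lazyMatrix G *ᵥ b i) ⬝ᵥ (fun _ => (1 : ℝ)) = b i ⬝ᵥ fun _ => 1 := by
        rw [dotProduct_comm, Matrix.dotProduct_mulVec, ← Matrix.mulVec_transpose,
          (show (lazyMatrix G)ᵀ = lazyMatrix G from lazyMatrix_isHermitian hd),
          lazyMatrix_mulVec_one hd hd0, dotProduct_comm]
      rw [hb, smul_dotProduct, smul_eq_mul] at h1
      have h2 : (e i - 1) * (b i ⬝ᵥ fun _ => (1 : ℝ)) = 0 := by linarith
      exact (mul_eq_zero.1 h2).resolve_left (sub_ne_zero.2 (hlt i))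
    have := congrFun this r
    norm_num at this
  refine ⟨Finset.univ.erase i₀, e, ?_, ?_, ?_, ⟨i₁, by simp [hne.symm], hgap.symm⟩, ?_⟩
  · rw [Finset.card_erase_of_mem (Finset.mem_univ _), Finset.card_univ,
      Nat.cast_sub (by omega)]
    simp
  · intro m
    have h1 := htr m
    have h2 : (lazyMatrix G ^ m).trace = Fintype.card V * (lazyMatrix G ^ m) r r := by
      have : ∀ x, (lazyMatrix G ^ m) x x = (lazyMatrix G ^ m) r r := fun x => by
        obtain ⟨φ, rfl⟩ := hT r x
        exact lazyMatrix_pow_map φ m r r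
      simp [Matrix.trace, this]
    rw [← Finset.add_sum_erase _ _ (Finset.mem_univ i₀), hi₀, h2, one_pow] at h1
    unfold excess
    rw [mul_sub, h1]
    field_simp
    ring
  · intro i hi
    rw [hgap]
    exact ⟨he0 i, hmax' i (Finset.ne_of_mem_erase hi)⟩
  · -- a combination of the first two eigenvectors that is orthogonal to the constants
    have : Nonempty V := ⟨r⟩
    set s₀ := ∑ x, b i₀ x
    set s₁ := ∑ x, b i₁ x
    -- The eigenvalue 1 has not been shown to be simple, so `b i₀` need not be constant and `b i₁`
    -- need not have sum zero.
    obtain ⟨α, β, hαβ, hpos⟩ : ∃ α β : ℝ, α * s₀ + β * s₁ = 0 ∧ 0 < α ^ 2 + β ^ 2 := by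
      by_cases h : s₀ = 0
      · exact ⟨1, 0, by rw [h]; ring, by norm_num⟩
      · refine ⟨-s₁, s₀, by ring, ?_⟩
        have : 0 < s₀ ^ 2 := by positivity
        nlinarith [sq_nonneg s₁]
    set f : V → ℝ := α • b i₀ + β • b i₁ with hf
    have hfsum : ∑ x, f x = 0 := by
      simp only [hf, Pi.add_apply, Pi.smul_apply, smul_eq_mul, Finset.sum_add_distrib,
        ← Finset.mul_sum]
      exact hαβ
    have hfsq : ∑ x, f x ^ 2 = α ^ 2 + β ^ 2 := by
      have : ∑ x, f x ^ 2 = f ⬝ᵥ f := by simp [dotProduct, sq]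
      rw [this, hf]
      simp only [add_dotProduct, dotProduct_add, smul_dotProduct, dotProduct_smul, horth, hne,
        hne.symm, if_true, if_false, smul_eq_mul]
      ring
    have hfq : f ⬝ᵥ (lazyMatrix G *ᵥ f) = α ^ 2 * e i₀ + β ^ 2 * e i₁ := by
      rw [hf, Matrix.mulVec_add, Matrix.mulVec_smul, Matrix.mulVec_smul, hb, hb]
      simp only [add_dotProduct, dotProduct_add, smul_dotProduct, dotProduct_smul, horth, hne,
        hne.symm, if_true, if_false, smul_eq_mul]
      ring
    have hP := poincare hd hd0 (fun S h1 h2 => degree_le_cut hG hT h1 h2 r) f hfsum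
    rw [dotProduct_lazyMatrix_eq hd hd0, hfsq] at hfq
    rw [hfsq] at hP
    have hE : energy G f = 4 * G.degree r * ((α ^ 2 + β ^ 2) - (α ^ 2 * e i₀ + β ^ 2 * e i₁)) := by
      rw [← hfq]; field_simp; ring
    have h1 : energy G f ≤ 4 * G.degree r * ((α ^ 2 + β ^ 2) * spectralGap G) := by
      rw [hE]
      have := mul_le_mul_of_nonneg_left (hmax i₁) (sq_nonneg α)
      have h3 : spectralGap G = 1 - e i₁ := by linarith
      rw [h3]
      gcongr
      linarith
    have h2 : 4 * (G.degree r : ℝ) * (α ^ 2 + β ^ 2) * 1 ≤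
        4 * (G.degree r : ℝ) * (α ^ 2 + β ^ 2) *
          ((Fintype.card V : ℝ) ^ 2 * spectralGap G) := by
      have := mul_le_mul_of_nonneg_left h1 (sq_nonneg (Fintype.card V : ℝ))
      linarith
    exact le_of_mul_le_mul_left h2 (by positivity)

theorem excess_zero (r : V) : excess G r 0 = 1 - 1 / (Fintype.card V : ℝ) := by
  simp [excess]

theorem excess_one (r : V) : excess G r 1 = 1 / 2 - 1 / (Fintype.card V : ℝ) := by
  simp [excess, lazyMatrix_apply]

end lazy

/-! ### Accuracy of the estimate of the spectral gap -/

section accuracy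

theorem pow_add_mul_le_add_pow {a b : ℝ} (ha : 0 ≤ a) (hb : 0 ≤ b) (k : ℕ) :
    a ^ (k + 1) + (k + 1) * a ^ k * b ≤ (a + b) ^ (k + 1) := by
  induction k with
  | zero => simp
  | succ k ih =>
    have h := mul_le_mul_of_nonneg_right ih (add_nonneg ha hb)
    rw [pow_succ (a + b) (k + 1)]
    refine le_trans ?_ h
    have : 0 ≤ (k + 1) * a ^ k * b * b := by positivity
    push_cast
    rw [pow_succ a (k + 1), pow_succ a k]
    linarith

/-- `λ - ε (1 - λ) ≤ λ · λ^ε` for `λ > 0` and `ε ≥ 0`. -/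
theorem sub_mul_le_mul_rpow {l ε : ℝ} (hl : 0 < l) (hε : 0 ≤ ε) :
    l - ε * (1 - l) ≤ l * l ^ ε := by
  -- The tangent bounds log l ≥ 1 - 1/l and exp u ≥ 1 + u give l^ε ≥ 1 + ε(1 - 1/l).
  have h1 := Real.one_sub_inv_le_log_of_pos hl
  have h2 : 1 + ε * (1 - l⁻¹) ≤ l ^ ε := by
    rw [Real.rpow_def_of_pos hl]
    have := Real.add_one_le_exp (Real.log l * ε)
    nlinarith
  calc l - ε * (1 - l) = l * (1 + ε * (1 - l⁻¹)) := by field_simp; ring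
    _ ≤ l * l ^ ε := by gcongr

variable {ι : Type*} {s : Finset ι} {e : ι → ℝ} {q : ℕ → ℝ} {n : ℕ} {τ : ℝ}

theorem excess_le_pow (hcard : (s.card : ℝ) = n - 1)
    (hq : ∀ m, (n : ℝ) * q m = ∑ i ∈ s, e i ^ m) (he : ∀ i ∈ s, 0 ≤ e i ∧ e i ≤ 1 - τ)
    (m : ℕ) : (n : ℝ) * q m ≤ (n - 1) * (1 - τ) ^ m := by
  rw [hq, ← hcard, ← nsmul_eq_mul]
  exact Finset.sum_le_card_nsmul _ _ _ fun i hi => pow_le_pow_left₀ (he i hi).1 (he i hi).2 m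

theorem pow_le_mul_excess (hq : ∀ m, (n : ℝ) * q m = ∑ i ∈ s, e i ^ m)
    (he : ∀ i ∈ s, 0 ≤ e i ∧ e i ≤ 1 - τ) (hex : ∃ i ∈ s, e i = 1 - τ) (m : ℕ) :
    (1 - τ) ^ m ≤ n * q m := by
  obtain ⟨i, hi, h⟩ := hex
  rw [hq, ← h]
  exact Finset.single_le_sum (f := fun i => e i ^ m) (fun j hj => pow_nonneg (he j hj).1 m) hi

/-- Chebyshev's sum inequality applies to the similarly ordered families `e i ^ m` and `e i`. The
mean of the `e i` is (n - 2)/(2(n - 1)), which is at least 1/4 exactly when n ≥ 3. -/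
theorem excess_le_four_mul_succ (hn : 3 ≤ n) (hcard : (s.card : ℝ) = n - 1)
    (hq : ∀ m, (n : ℝ) * q m = ∑ i ∈ s, e i ^ m) (he : ∀ i ∈ s, 0 ≤ e i)
    (hq1 : q 1 = 1 / 2 - 1 / n) (m : ℕ) : q m ≤ 4 * q (m + 1) := by
  have hn' : (3 : ℝ) ≤ n := by exact_mod_cast hn
  have hmono : MonovaryOn (fun i => e i ^ m) e s := fun i hi j hj hij =>
    pow_le_pow_left₀ (he i hi) hij.le m
  have h := hmono.sum_mul_sum_le_card_mul_sum
  have h1 := hq 1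
  simp only [pow_one] at h1
  have h2 : ∑ i ∈ s, e i ^ m * e i = ∑ i ∈ s, e i ^ (m + 1) := by simp only [pow_succ]
  rw [h2, ← hq, ← hq, ← h1, hcard, hq1] at h
  have h3 : (n : ℝ) * (1 / 2 - 1 / n) = (n - 2) / 2 := by field_simp
  rw [h3] at h
  have hqm : 0 ≤ n * q m := by rw [hq]; exact Finset.sum_nonneg fun i hi => pow_nonneg (he i hi) m
  have h4 : (n : ℝ) * q m * ((n - 1) / 4) ≤ n * q m * ((n - 2) / 2) :=
    mul_le_mul_of_nonneg_left (by linarith) hqm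
  have h5 : (n * (n - 1) : ℝ) * (q m / 4) ≤ n * (n - 1) * q (m + 1) := by linarith
  have := le_of_mul_le_mul_left h5 (by nlinarith)
  linarith

theorem pow_rpow_one_div_succ {x : ℝ} (hx : 0 ≤ x) (k : ℕ) :
    (x ^ (k + 1)) ^ (1 / ((k + 1 : ℕ) : ℝ)) = x := by
  rw [one_div, Real.pow_rpow_inv_natCast hx (Nat.succ_ne_zero k)]

/-- The term (ε/7) λ^k is at most (k + 1) λ^k · ετ, the second term in the binomial expansion of (λ
+ ετ)^(k+1). -/
theorem rpow_le_of_le_pow_add {ε Q : ℝ} {k : ℕ} (hl0 : 0 ≤ 1 - τ) (hτ0 : 0 ≤ τ) (hε : 0 ≤ ε)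
    (hkτ : 1 / 7 ≤ (k + 1 : ℝ) * τ) (hQ0 : 0 ≤ Q)
    (hQ : Q ≤ (1 - τ) ^ (k + 1) + ε / 7 * (1 - τ) ^ k) :
    Q ^ (1 / ((k + 1 : ℕ) : ℝ)) ≤ 1 - τ + ε * τ := by
  have h1 : Q ≤ ((1 - τ) + ε * τ) ^ (k + 1) := by
    have h2 := pow_add_mul_le_add_pow hl0 (show 0 ≤ ε * τ by positivity) k
    have h8 : ε * (1 - τ) ^ k * (1 / 7) ≤ ε * (1 - τ) ^ k * ((k + 1) * τ) :=
      mul_le_mul_of_nonneg_left hkτ (by positivity)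
    linarith
  have h2 := Real.rpow_le_rpow hQ0 h1 (show 0 ≤ 1 / ((k + 1 : ℕ) : ℝ) by positivity)
  rwa [pow_rpow_one_div_succ (by positivity)] at h2

/-- (λ - ετ)^(k+1) is at most λ^(k+1) (λ^(k+1))^ε, whose last factor is at most (9/8) n^(-2); for n
≥ 3 this is below the available 3/(7n). -/
theorem le_rpow_of_pow_div_le {ε Q : ℝ} {k : ℕ} (hl : 0 < 1 - τ) (hε : 0 < ε) (hε1 : ε < 1)
    (hn : (3 : ℝ) ≤ n) (hlk : (1 - τ) ^ (k + 1) ≤ 9 / 8 * (n : ℝ) ^ (-(2 / ε)))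
    (hQ : 3 / 7 * ((1 - τ) ^ (k + 1) / n) ≤ Q) :
    1 - τ - ε * τ ≤ Q ^ (1 / ((k + 1 : ℕ) : ℝ)) := by
  have hn0 : (0 : ℝ) < n := by linarith
  have hQ0 : 0 ≤ Q := le_trans (by positivity) hQ
  rcases le_total (1 - τ - ε * τ) 0 with h0 | h0
  · exact h0.trans (Real.rpow_nonneg hQ0 _)
  have h2 := sub_mul_le_mul_rpow hl hε.le
  rw [sub_sub_cancel] at h2
  have h3 := pow_le_pow_left₀ h0 h2 (k + 1)
  have h4 : ((1 - τ) ^ ε) ^ (k + 1) = ((1 - τ) ^ (k + 1)) ^ ε := by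
    rw [← Real.rpow_natCast, ← Real.rpow_natCast, ← Real.rpow_mul hl.le,
      ← Real.rpow_mul hl.le, mul_comm]
  have hn2 : ((n : ℝ) ^ (-(2 / ε))) ^ ε = 1 / (n : ℝ) ^ 2 := by
    rw [← Real.rpow_mul hn0.le]
    have : -(2 / ε) * ε = -2 := by field_simp
    rw [this, Real.rpow_neg hn0.le, one_div]
    norm_cast
  have h98 : (9 / 8 : ℝ) ^ ε ≤ 9 / 8 := by
    conv_rhs => rw [← Real.rpow_one (9 / 8 : ℝ)]
    exact Real.rpow_le_rpow_of_exponent_le (by norm_num) hε1.le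
  have h5 : ((1 - τ) ^ (k + 1)) ^ ε ≤ 9 / 8 * (1 / (n : ℝ) ^ 2) := by
    refine (Real.rpow_le_rpow (by positivity) hlk hε.le).trans ?_
    rw [Real.mul_rpow (by norm_num) (by positivity), hn2]
    gcongr
  rw [mul_pow, h4] at h3
  have h6 : 0 < (1 - τ) ^ (k + 1) := by positivity
  have h7 : (1 - τ) ^ (k + 1) * ((1 - τ) ^ (k + 1)) ^ ε ≤ 3 / 7 * ((1 - τ) ^ (k + 1) / n) := by
    calc (1 - τ) ^ (k + 1) * ((1 - τ) ^ (k + 1)) ^ ε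
        ≤ (1 - τ) ^ (k + 1) * (9 / 8 * (1 / (n : ℝ) ^ 2)) :=
          mul_le_mul_of_nonneg_left h5 h6.le
      _ = 9 / 8 / n * ((1 - τ) ^ (k + 1) / n) := by field_simp
      _ ≤ 3 / 7 * ((1 - τ) ^ (k + 1) / n) := by
          refine mul_le_mul_of_nonneg_right ?_ (by positivity)
          rw [div_le_iff₀ hn0]; linarith
  have h8 := Real.rpow_le_rpow (by positivity) (h3.trans (h7.trans hQ))
    (show 0 ≤ 1 / ((k + 1 : ℕ) : ℝ) by positivity)
  rwa [pow_rpow_one_div_succ h0] at h8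

/-- Here `k + 1` is the crossing point found by the search. The crossing gives q_k ≥ 7θ/8 and
q_(k+1) ≤ 9θ/8; the first makes the sampling error relative to q_k, the second makes λ^(k+1) small.
-/
theorem gap_accuracy (hn : 2 ≤ n) (hcard : (s.card : ℝ) = n - 1)
    (hq : ∀ m, (n : ℝ) * q m = ∑ i ∈ s, e i ^ m) (he : ∀ i ∈ s, 0 ≤ e i ∧ e i ≤ 1 - τ)
    (hex : ∃ i ∈ s, e i = 1 - τ) (hq1 : q 1 = 1 / 2 - 1 / n)
    {ε c : ℝ} (hε : 0 < ε) (hε1 : ε < 1) (hc : 1 + 2 / ε ≤ c) {k : ℕ} {Q Q' : ℝ}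
    (hQ : Q ≤ threshold n c) (hQ' : threshold n c < Q') (hη : |q (k + 1) - Q| < tolerance n c ε)
    (hη' : |q k - Q'| < tolerance n c ε) :
    (1 - ε) * τ ≤ 1 - Q ^ (1 / ((k + 1 : ℕ) : ℝ)) ∧
      1 - Q ^ (1 / ((k + 1 : ℕ) : ℝ)) ≤ (1 + ε) * τ := by
  have hn' : (2 : ℝ) ≤ n := by exact_mod_cast hn
  have hn0 : (0 : ℝ) < n := by linarith
  set θ := threshold n c with hθ
  have hθ0 : 0 < θ := by rw [hθ, threshold]; positivity
  have htol : tolerance n c ε = ε / 8 * θ := by rw [hθ, threshold, tolerance]; field_simp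
  rw [htol] at hη hη'
  rw [abs_lt] at hη hη'
  have hl0 : 0 ≤ 1 - τ := by obtain ⟨i, hi, h⟩ := hex; rw [← h]; exact (he i hi).1
  have hτ1 : τ ≤ 1 := by linarith
  have hcgt : 2 / ε ≤ c - 1 := by linarith
  have h2ε : 2 ≤ 2 / ε := by rw [le_div_iff₀ hε]; linarith
  -- The choice of c enters here: nθ = n^(1-c), and c ≥ 1 + 2/ε.
  have hnθ : n * θ ≤ (n : ℝ) ^ (-(2 / ε)) := by
    have : n * θ = (n : ℝ) ^ (1 - c) := by
      rw [hθ, threshold, Real.rpow_sub hn0, Real.rpow_one]; ring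
    rw [this]
    exact Real.rpow_le_rpow_of_exponent_le (by linarith) (by linarith)
  have hn4 : (n : ℝ) ^ (-(2 / ε)) ≤ 1 / 4 := by
    calc (n : ℝ) ^ (-(2 / ε)) ≤ (n : ℝ) ^ (-2 : ℝ) :=
          Real.rpow_le_rpow_of_exponent_le (by linarith) (by linarith)
      _ = 1 / (n : ℝ) ^ 2 := by rw [Real.rpow_neg hn0.le, one_div]; norm_cast
      _ ≤ 1 / 2 ^ 2 := by gcongr
      _ = 1 / 4 := by norm_num
  have hθ4 : θ ≤ 1 / 4 :=
    (le_mul_of_one_le_left hθ0.le (by linarith)).trans (hnθ.trans hn4)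
  have hεθ : ε / 8 * θ ≤ 1 / 8 * θ := mul_le_mul_of_nonneg_right (by linarith) hθ0.le
  have hF3 : θ * (7 / 8) ≤ q k := by linarith
  have hηq : ε / 8 * θ ≤ ε / 7 * q k := by
    have := mul_le_mul_of_nonneg_left hF3 (show 0 ≤ ε / 7 by positivity)
    linarith
  have hF4 : q (k + 1) ≤ 9 / 8 * θ := by linarith
  have hpow_le := excess_le_pow hcard hq he
  have hle_pow := pow_le_mul_excess hq he hex
  have hF1 : ∀ m, q m ≤ (1 - τ) ^ m := fun m => by
    have h1 := hpow_le m
    have h2 : 0 ≤ (1 - τ) ^ m := by positivity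
    have h3 : (n : ℝ) * q m ≤ n * (1 - τ) ^ m := by linarith
    exact le_of_mul_le_mul_left h3 hn0
  have hlk : (1 - τ) ^ (k + 1) ≤ 9 / 8 * (n : ℝ) ^ (-(2 / ε)) := by
    have h1 := hle_pow (k + 1)
    have h2 := mul_le_mul_of_nonneg_left hF4 hn0.le
    linarith
  -- Bernoulli: 1 - (k + 1)τ ≤ λ^(k+1) ≤ (9/8)(1/4) = 9/32.
  have hkτ : 23 / 32 ≤ (k + 1 : ℝ) * τ := by
    have := one_add_mul_le_pow (show (-2 : ℝ) ≤ -τ by linarith) (k + 1)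
    push_cast at this
    have h2 : (1 + -τ) = 1 - τ := by ring
    rw [h2] at this
    linarith
  have hτ0 : 0 < τ := by
    by_contra h
    push Not at h
    have := mul_nonpos_of_nonneg_of_nonpos (show (0 : ℝ) ≤ k + 1 by positivity) h
    linarith
  -- For n = 2 the factor 4 is unavailable, as q₁ = 0. But then λ = 0, the crossing is at the first
  -- step, and |Q| < εθ/8 is enough.
  rcases Nat.lt_or_ge n 3 with h3 | h3
  · have hn2 : n = 2 := by omega
    subst hn2
    have hq1' : q 1 = 0 := by rw [hq1]; norm_num
    have h1 := hle_pow 1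
    rw [hq1'] at h1
    have hτ : τ = 1 := by
      simp at h1; linarith
    have hk : k = 0 := by
      by_contra hk
      have := hF1 k
      rw [hτ, sub_self, zero_pow hk] at this
      linarith
    subst hk
    rw [hτ]
    simp only [zero_add, Nat.cast_one, div_one, Real.rpow_one]
    rw [zero_add, hq1'] at hη
    have := mul_le_mul_of_nonneg_left hθ4 hε.le
    constructor <;> linarith
  · have hn3 : (3 : ℝ) ≤ n := by exact_mod_cast h3
    have hF5 := excess_le_four_mul_succ h3 hcard hq (fun i hi => (he i hi).1) hq1 k
    have hqk0 : 0 < q k := by linarith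
    have hqk1 : 0 < q (k + 1) := by linarith
    have hl : 0 < 1 - τ := by
      rcases hl0.eq_or_lt with h | h
      · have := hF1 (k + 1)
        rw [← h, zero_pow (Nat.succ_ne_zero k)] at this
        linarith
      · exact h
    have hηq' : ε / 8 * θ ≤ 4 / 7 * q (k + 1) := by
      have := mul_le_mul_of_nonneg_right hε1.le hqk0.le
      linarith
    have hQ0 : 0 ≤ Q := by linarith
    constructor
    · have := rpow_le_of_le_pow_add (Q := Q) (k := k) hl0 hτ0.le hε.le (by linarith) hQ0 (by
        have h1 := hF1 (k + 1)
        have h2 := mul_le_mul_of_nonneg_left (hF1 k) (show 0 ≤ ε / 7 by positivity)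
        linarith)
      linarith
    · have := le_rpow_of_pow_div_le (Q := Q) (k := k) hl hε hε1 hn3 hlk (by
        have h1 := hle_pow (k + 1)
        have h2 : (1 - τ) ^ (k + 1) / n ≤ q (k + 1) := by rwa [div_le_iff₀' hn0]
        linarith)
      linarith

end accuracy

/-! ### The Markov property -/

section markov

variable {V : Type*}

/-- Membership in `A` depends only on the path up to time `t`. -/
def DeterminedAt (t : ℕ) (A : Set (ℕ → V)) : Prop :=
  ∀ x y : ℕ → V, (∀ s ≤ t, x s = y s) → x ∈ A → y ∈ A

theorem DeterminedAt.inter {t : ℕ} {A B : Set (ℕ → V)} (hA : DeterminedAt t A)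
    (hB : DeterminedAt t B) : DeterminedAt t (A ∩ B) :=
  fun x y h hx => ⟨hA x y h hx.1, hB x y h hx.2⟩

theorem DeterminedAt.mono {t u : ℕ} (htu : t ≤ u) {A : Set (ℕ → V)} (hA : DeterminedAt t A) :
    DeterminedAt u A :=
  fun x y h hx => hA x y (fun s hs => h s (hs.trans htu)) hx

/-- The paths that agree with `x` up to time `t`. -/
def pathCylinder (x : ℕ → V) (t : ℕ) : Set (ℕ → V) := {y | ∀ s ≤ t, y s = x s}

/-- Continuation of a finite path by its last value. -/
def extendPath {t : ℕ} (p : Fin (t + 1) → V) : ℕ → V := fun s => p ⟨min s t, by omega⟩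

/-- Initial segment of a path. -/
def restrictPath (t : ℕ) (x : ℕ → V) : Fin (t + 1) → V := fun i => x i

/-- The path from time `t` on. -/
def shiftPath (t : ℕ) (x : ℕ → V) : ℕ → V := fun s => x (t + s)

theorem extendPath_restrictPath {t : ℕ} (x : ℕ → V) {s : ℕ} (hs : s ≤ t) :
    extendPath (restrictPath t x) s = x s := by
  simp [extendPath, restrictPath, min_eq_left hs]

theorem restrictPath_preimage_singleton {t : ℕ} (p : Fin (t + 1) → V) :
    restrictPath t ⁻¹' {p} = pathCylinder (extendPath p) t := by
  ext x
  simp only [Set.mem_preimage, Set.mem_singleton_iff]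
  constructor
  · rintro rfl s hs
    exact (extendPath_restrictPath x hs).symm
  · intro h
    ext i
    have := h i (by omega)
    simp only [restrictPath, this, extendPath]
    congr 1
    ext; simp; omega

variable [Fintype V] [MeasurableSpace V] [MeasurableSingletonClass V]

theorem measurable_restrictPath (t : ℕ) : Measurable (restrictPath (V := V) t) :=
  measurable_pi_lambda _ fun _ => measurable_pi_apply _

theorem measurable_shiftPath (t : ℕ) : Measurable (shiftPath (V := V) t) :=
  measurable_pi_lambda _ fun _ => measurable_pi_apply _

theorem measurableSet_coord (t : ℕ) (v : V) : MeasurableSet {x : ℕ → V | x t = v} :=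
  (measurable_pi_apply (X := fun _ : ℕ => V) t) (measurableSet_singleton v)

/-- With finitely many nodes there are only finitely many initial segments of a given length. -/
theorem DeterminedAt.measurableSet {t : ℕ} {A : Set (ℕ → V)} (hA : DeterminedAt t A) :
    MeasurableSet A := by
  have : A = restrictPath t ⁻¹' {p | extendPath p ∈ A} := by
    ext x
    refine ⟨hA x _ fun s hs => (extendPath_restrictPath x hs).symm,
      hA _ x fun s hs => extendPath_restrictPath x hs⟩
  rw [this]
  exact measurable_restrictPath t (Set.toFinite _).measurableSet

theorem sum_measureReal_inter_preimage {α β : Type*} [MeasurableSpace α] [Fintype β]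
    [MeasurableSpace β] [MeasurableSingletonClass β] (ν : Measure α) [IsFiniteMeasure ν]
    {f : α → β} (hf : Measurable f) (B : Set α) :
    ∑ b, ν.real (B ∩ f ⁻¹' {b}) = ν.real B := by
  have h := sum_measureReal_preimage_singleton (μ := ν.restrict B) Finset.univ (f := f)
    (fun b _ => hf (measurableSet_singleton b))
  simp only [Finset.coe_univ, Set.preimage_univ] at h
  rw [measureReal_restrict_apply MeasurableSet.univ, Set.univ_inter] at h
  rw [← h]
  refine Finset.sum_congr rfl fun b _ => ?_
  rw [measureReal_restrict_apply (hf (measurableSet_singleton b)), Set.inter_comm]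

theorem DeterminedAt.measureReal_eq_of_pathCylinder {ν₁ ν₂ : Measure (ℕ → V)}
    [IsFiniteMeasure ν₁] [IsFiniteMeasure ν₂]
    (h : ∀ x t, ν₁.real (pathCylinder x t) = ν₂.real (pathCylinder x t)) {t : ℕ}
    {A : Set (ℕ → V)} (hA : DeterminedAt t A) : ν₁.real A = ν₂.real A := by
  rw [← sum_measureReal_inter_preimage ν₁ (measurable_restrictPath t),
    ← sum_measureReal_inter_preimage ν₂ (measurable_restrictPath t)]
  refine Finset.sum_congr rfl fun p _ => ?_
  rw [restrictPath_preimage_singleton]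
  by_cases hp : extendPath p ∈ A
  · have : A ∩ pathCylinder (extendPath p) t = pathCylinder (extendPath p) t :=
      Set.inter_eq_right.2 fun y hy => hA _ y (fun s hs => (hy s hs).symm) hp
    rw [this, h]
  · have : A ∩ pathCylinder (extendPath p) t = ∅ := by
      rw [Set.eq_empty_iff_forall_notMem]
      rintro y ⟨hy, hy'⟩
      exact hp (hA y _ hy' hy)
    simp [this]

theorem measure_ext_of_pathCylinder {ν₁ ν₂ : Measure (ℕ → V)} [IsFiniteMeasure ν₁]
    [IsFiniteMeasure ν₂]
    (h : ∀ x t, ν₁.real (pathCylinder x t) = ν₂.real (pathCylinder x t)) : ν₁ = ν₂ := by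
  have key : ∀ t (A : Set (ℕ → V)), DeterminedAt t A → ν₁ A = ν₂ A := fun t A hA => by
    have := hA.measureReal_eq_of_pathCylinder h
    rwa [measureReal_eq_measureReal_iff] at this
  refine ext_of_generate_finite _ generateFrom_measurableCylinders.symm
    isPiSystem_measurableCylinders (fun s hs => ?_) (key 0 _ fun _ _ _ _ => trivial)
  obtain ⟨I, S, -, rfl⟩ := (mem_measurableCylinders s).1 hs
  refine key (I.sup id) _ fun x y hxy hx => ?_
  rw [mem_cylinder] at hx ⊢
  convert hx using 1
  ext ⟨i, hi⟩
  exact (hxy i (Finset.le_sup (f := id) hi)).symm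

variable [DecidableEq V] {G : SimpleGraph V} [DecidableRel G.Adj] {r : V}
  {P : Measure (ℕ → V)} [IsProbabilityMeasure P]

theorem IsLazyWalk.cylinder (hP : IsLazyWalk G r P fun t x => x t) (x : ℕ → V) (t : ℕ) :
    P.real (pathCylinder x t) =
      if x 0 = r then ∏ s ∈ Finset.range t, lazyMatrix G (x s) (x (s + 1)) else 0 :=
  hP.law t x

theorem IsLazyWalk.cylinder_succ (hP : IsLazyWalk G r P fun t x => x t) (x : ℕ → V) (t : ℕ) :
    P.real (pathCylinder x (t + 1)) =
      P.real (pathCylinder x t) * lazyMatrix G (x t) (x (t + 1)) := by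
  rw [hP.cylinder, hP.cylinder, Finset.prod_range_succ]
  split_ifs <;> simp

/-- Split along initial segments: a segment that lies in `A` and ends at `a` is a single cylinder,
and the step to `b` lengthens it by one factor. -/
theorem IsLazyWalk.one_step (hP : IsLazyWalk G r P fun t x => x t) {t : ℕ} {A : Set (ℕ → V)}
    (hA : DeterminedAt t A) (a b : V) :
    P.real (A ∩ {x | x t = a ∧ x (t + 1) = b}) =
      P.real (A ∩ {x | x t = a}) * lazyMatrix G a b := by
  rw [← sum_measureReal_inter_preimage P (measurable_restrictPath t),
    ← sum_measureReal_inter_preimage P (measurable_restrictPath t), Finset.sum_mul]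
  refine Finset.sum_congr rfl fun p _ => ?_
  rw [restrictPath_preimage_singleton]
  by_cases hp : extendPath p ∈ A ∧ extendPath p t = a
  · set z : ℕ → V := fun s => if s ≤ t then extendPath p s else b with hz
    have hzs : ∀ s ≤ t, z s = extendPath p s := fun s hs => by simp [hz, hs]
    have h1 : A ∩ {x | x t = a ∧ x (t + 1) = b} ∩ pathCylinder (extendPath p) t =
        pathCylinder z (t + 1) := by
      ext y
      constructor
      · rintro ⟨⟨-, -, hb⟩, hy⟩ s hs
        rcases Nat.lt_or_ge t s with h | h
        · have : s = t + 1 := by omega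
          subst this
          simp [hz, hb]
        · rw [hzs s h]; exact hy s h
      · intro hy
        have hy' : y ∈ pathCylinder (extendPath p) t := fun s hs => by
          rw [← hzs s hs]; exact hy s (by omega)
        refine ⟨⟨hA _ y (fun s hs => (hy' s hs).symm) hp.1, ?_, ?_⟩, hy'⟩
        · rw [hy' t le_rfl]; exact hp.2
        · rw [hy (t + 1) le_rfl]; simp [hz]
    have h2 : A ∩ {x | x t = a} ∩ pathCylinder (extendPath p) t = pathCylinder z t := by
      ext y
      constructor
      · rintro ⟨-, hy⟩ s hs
        rw [hzs s hs]; exact hy s hs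
      · intro hy
        have hy' : y ∈ pathCylinder (extendPath p) t := fun s hs => by
          rw [← hzs s hs]; exact hy s hs
        refine ⟨⟨hA _ y (fun s hs => (hy' s hs).symm) hp.1, ?_⟩, hy'⟩
        exact (hy' t le_rfl).trans hp.2
    rw [h1, h2, hP.cylinder_succ, hzs t le_rfl, hp.2]
    simp [hz]
  · have h2 : A ∩ {x | x t = a} ∩ pathCylinder (extendPath p) t = ∅ := by
      rw [Set.eq_empty_iff_forall_notMem]
      rintro y ⟨⟨hy, hya⟩, hy'⟩
      exact hp ⟨hA y _ hy' hy, (hy' t le_rfl).symm.trans hya⟩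
    have h1 : A ∩ {x | x t = a ∧ x (t + 1) = b} ∩ pathCylinder (extendPath p) t = ∅ :=
      Set.subset_empty_iff.1 (h2 ▸ fun y hy => ⟨⟨hy.1.1, hy.1.2.1⟩, hy.2⟩)
    simp [h1, h2]

/-- It suffices to compare cylinders, by induction on their length: `A` together with a shifted
cylinder is again determined at a finite time, so `IsLazyWalk.one_step` extends it. -/
theorem IsLazyWalk.map_shiftPath (hP : IsLazyWalk G r P fun t x => x t) {t : ℕ}
    {A : Set (ℕ → V)} (hA : DeterminedAt t A) (hAr : ∀ x ∈ A, x t = r) :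
    (P.restrict A).map (shiftPath t) = P A • P := by
  have : IsFiniteMeasure (P A • P) := Measure.smul_finite P (measure_ne_top P A)
  refine measure_ext_of_pathCylinder fun z u => ?_
  have hcm : MeasurableSet (pathCylinder z u) :=
    DeterminedAt.measurableSet (t := u) fun x y h hx s hs => (h s hs).symm.trans (hx s hs)
  rw [map_measureReal_apply (measurable_shiftPath t) hcm,
    measureReal_restrict_apply (measurable_shiftPath t hcm), measureReal_ennreal_smul_apply]
  change _ = P.real A * _
  clear hcm
  induction u with
  | zero =>
    rw [hP.cylinder]
    by_cases hz : z 0 = r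
    · have : shiftPath t ⁻¹' pathCylinder z 0 ∩ A = A := by
        refine Set.inter_eq_right.2 fun x hx s hs => ?_
        obtain rfl : s = 0 := by omega
        rw [hz]; exact hAr x hx
      simp [this, hz]
    · have : shiftPath t ⁻¹' pathCylinder z 0 ∩ A = ∅ := by
        rw [Set.eq_empty_iff_forall_notMem]
        rintro x ⟨hx, hxA⟩
        exact hz ((hx 0 le_rfl).symm.trans (hAr x hxA))
      simp [this, hz]
  | succ u ih =>
    rw [hP.cylinder_succ, ← mul_assoc, ← ih]
    have hdet : DeterminedAt (t + u) (shiftPath t ⁻¹' pathCylinder z u ∩ A) := by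
      refine DeterminedAt.inter ?_ (hA.mono (Nat.le_add_right _ _))
      intro x y h hx s hs
      exact (h (t + s) (by omega)).symm.trans (hx s hs)
    have h := hP.one_step hdet (z u) (z (u + 1))
    have h1 : shiftPath t ⁻¹' pathCylinder z u ∩ A ∩ {x | x (t + u) = z u} =
        shiftPath t ⁻¹' pathCylinder z u ∩ A :=
      Set.inter_eq_left.2 fun x hx => hx.1 u le_rfl
    have h2 : shiftPath t ⁻¹' pathCylinder z u ∩ A ∩
        {x | x (t + u) = z u ∧ x (t + u + 1) = z (u + 1)} =
        shiftPath t ⁻¹' pathCylinder z (u + 1) ∩ A := by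
      ext x
      constructor
      · rintro ⟨⟨hx, hxA⟩, -, h2⟩
        refine ⟨fun s hs => ?_, hxA⟩
        rcases Nat.lt_or_ge u s with h | h
        · obtain rfl : s = u + 1 := by omega
          exact h2
        · exact hx s h
      · rintro ⟨hx, hxA⟩
        exact ⟨⟨fun s hs => hx s (by omega), hxA⟩, hx u (by omega), hx (u + 1) le_rfl⟩
    rw [h1, h2] at h
    exact h

/-- The Markov property: after a visit to `r` at time `t` the walk starts afresh. -/
theorem IsLazyWalk.markov (hP : IsLazyWalk G r P fun t x => x t) {t : ℕ} {A B : Set (ℕ → V)}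
    (hA : DeterminedAt t A) (hAr : ∀ x ∈ A, x t = r) (hB : NullMeasurableSet B P) :
    P (A ∩ shiftPath t ⁻¹' B) = P A * P B := by
  have h := hP.map_shiftPath hA hAr
  -- Events about return times will be available only up to null sets; null measurability passes to
  -- the shifted law because that law is a multiple of `P`.
  have hB' : NullMeasurableSet B ((P.restrict A).map (shiftPath t)) := by
    rw [h]
    exact hB.mono_ac (Measure.smul_absolutelyContinuous)
  have h2 := congrArg (fun ν : Measure (ℕ → V) => ν B) h
  simp only [Measure.smul_apply, smul_eq_mul] at h2
  rw [← h2, Measure.map_apply₀ (measurable_shiftPath t).aemeasurable hB',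
    Measure.restrict_apply' hA.measurableSet, Set.inter_comm]

theorem IsLazyWalk.measureReal_coord (hP : IsLazyWalk G r P fun t x => x t) (m : ℕ) (y : V) :
    P.real {x | x m = y} = (lazyMatrix G ^ m) r y := by
  induction m generalizing y with
  | zero =>
    have : {x : ℕ → V | x 0 = y} = pathCylinder (fun _ => y) 0 := by
      ext x; simp [pathCylinder]
    rw [this, hP.cylinder, pow_zero, Matrix.one_apply]
    simp [eq_comm]
  | succ m ih =>
    rw [← sum_measureReal_inter_preimage P (measurable_pi_apply m), pow_succ, Matrix.mul_apply]
    refine Finset.sum_congr rfl fun a _ => ?_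
    have h := hP.one_step (t := m) (A := Set.univ) (fun _ _ _ _ => trivial) a y
    rw [Set.univ_inter, Set.univ_inter, ih] at h
    rw [← h]
    congr 1
    ext x
    simp [and_comm]

end markov

/-! ### Expected return time -/

section kac

variable {V : Type*} [Fintype V] [DecidableEq V]

/-- The probability that the chain with transition matrix `M`, started at `x`, does not visit `r`
at the times `0, …, t`. -/
def avoidFrom (M : Matrix V V ℝ) (r : V) : ℕ → V → ℝ
  | 0, x => if x = r then 0 else 1
  | t + 1, x => if x = r then 0 else ∑ y, M x y * avoidFrom M r t y

/-- The probability that the chain with transition matrix `M`, started at `r`, is at `y` at time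
`t` and does not visit `r` at the times `1, …, t`. -/
def avoidTo (M : Matrix V V ℝ) (r : V) : ℕ → V → ℝ
  | 0, y => if y = r then 1 else 0
  | t + 1, y => if y = r then 0 else ∑ x, avoidTo M r t x * M x y

variable {M : Matrix V V ℝ} {r : V}

theorem avoidFrom_self (t : ℕ) : avoidFrom M r t r = 0 := by
  cases t <;> simp [avoidFrom]

/-- For a transition matrix both sides are the probability of avoiding `r` at the times 1, …, s + t
+ 2, with the path cut at time s + 1 or s + 2. -/
theorem sum_avoidTo_mul_avoidFrom (s t : ℕ) :
    ∑ x, avoidTo M r (s + 1) x * avoidFrom M r (t + 1) x =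
      ∑ x, avoidTo M r (s + 2) x * avoidFrom M r t x := by
  have h1 : ∀ x, avoidTo M r (s + 1) x * avoidFrom M r (t + 1) x =
      ∑ y, avoidTo M r (s + 1) x * M x y * avoidFrom M r t y := by
    intro x
    by_cases hx : x = r
    · simp [avoidTo, avoidFrom, hx]
    · simp only [avoidFrom, hx, if_false, Finset.mul_sum, mul_assoc]
  have h2 : ∀ y, avoidTo M r (s + 2) y * avoidFrom M r t y =
      ∑ x, avoidTo M r (s + 1) x * M x y * avoidFrom M r t y := by
    intro y
    by_cases hy : y = r
    · simp [hy, avoidFrom_self]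
    · rw [avoidTo, if_neg hy, Finset.sum_mul]
  simp only [h1, h2]
  exact Finset.sum_comm

theorem sum_avoidTo_succ (t : ℕ) :
    ∑ y, avoidTo M r (t + 1) y = ∑ y, M r y * avoidFrom M r t y := by
  have h : ∀ k s, k + s = t → ∑ y, avoidTo M r (k + 1) y * avoidFrom M r s y =
      ∑ y, M r y * avoidFrom M r t y := by
    intro k
    induction k with
    | zero =>
      intro s hs
      obtain rfl : s = t := by omega
      refine Finset.sum_congr rfl fun y _ => ?_
      by_cases hy : y = r
      · simp [hy, avoidFrom_self]
      · simp [avoidTo, hy]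
    | succ k ih =>
      intro s hs
      rw [← ih (s + 1) (by omega)]
      exact (sum_avoidTo_mul_avoidFrom k s).symm
  rw [← h t 0 (by omega)]
  refine Finset.sum_congr rfl fun y _ => ?_
  by_cases hy : y = r <;> simp [avoidTo, avoidFrom, hy]

/-- Kac's formula in finite form. As the columns sum to 1, the total of `avoidFrom` loses in one
step exactly the row of `r`, and that row is the next `avoidTo` total by `sum_avoidTo_succ`. -/
theorem sum_range_sum_avoidTo (hcol : ∀ y, ∑ x, M x y = 1) (N : ℕ) :
    ∑ t ∈ Finset.range (N + 1), ∑ y, avoidTo M r t y =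
      Fintype.card V - ∑ x, avoidFrom M r N x := by
  induction N with
  | zero =>
    have h1 : ∑ y, avoidTo M r 0 y = 1 := by simp [avoidTo]
    have h2 : ∑ x, avoidFrom M r 0 x = Fintype.card V - 1 := by
      have : ∀ x, avoidFrom M r 0 x = 1 - if x = r then 1 else 0 := fun x => by
        by_cases hx : x = r <;> simp [avoidFrom, hx]
      simp [this]
    rw [zero_add, Finset.sum_range_one, h1, h2]; ring
  | succ N ih =>
    rw [Finset.sum_range_succ, ih, sum_avoidTo_succ]
    have h1 : ∑ x, avoidFrom M r N x = ∑ x, ∑ y, M x y * avoidFrom M r N y := by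
      rw [Finset.sum_comm]
      refine Finset.sum_congr rfl fun y _ => ?_
      rw [← Finset.sum_mul, hcol, one_mul]
    have h2 : ∑ x, ∑ y, M x y * avoidFrom M r N y =
        ∑ y, M r y * avoidFrom M r N y + ∑ x, avoidFrom M r (N + 1) x := by
      rw [← Finset.add_sum_erase _ _ (Finset.mem_univ r),
        ← Finset.add_sum_erase _ (avoidFrom M r (N + 1)) (Finset.mem_univ r), avoidFrom_self,
        zero_add]
      congr 1
      refine Finset.sum_congr rfl fun x hx => ?_
      rw [avoidFrom, if_neg (Finset.ne_of_mem_erase hx)]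
    linarith

theorem avoidFrom_nonneg (hM : ∀ x y, 0 ≤ M x y) (t : ℕ) (x : V) : 0 ≤ avoidFrom M r t x := by
  induction t generalizing x with
  | zero => rw [avoidFrom]; split_ifs <;> norm_num
  | succ t ih =>
    rw [avoidFrom]
    split_ifs
    · rfl
    · exact Finset.sum_nonneg fun y _ => mul_nonneg (hM x y) (ih y)

theorem avoidFrom_succ_le (hM : ∀ x y, 0 ≤ M x y) (hrow : ∀ x, ∑ y, M x y = 1) (t : ℕ) (x : V) :
    avoidFrom M r (t + 1) x ≤ avoidFrom M r t x := by
  induction t generalizing x with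
  | zero =>
    simp only [avoidFrom]
    split_ifs with h
    · rfl
    · exact le_of_le_of_eq (Finset.sum_le_sum fun y _ =>
        mul_le_of_le_one_right (hM x y) (by by_cases hy : y = r <;> simp [hy])) (hrow x)
  | succ t ih =>
    rw [avoidFrom, avoidFrom]
    split_ifs
    · rfl
    · exact Finset.sum_le_sum fun y _ => mul_le_mul_of_nonneg_left (ih y) (hM x y)

/-- Maximum principle: the decreasing limits are harmonic off `r` and vanish at `r`. A positive
maximum would spread along edges to every node, including `r`. -/
theorem tendsto_avoidFrom {G : SimpleGraph V} (hG : G.Connected) (hM : ∀ x y, 0 ≤ M x y)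
    (hrow : ∀ x, ∑ y, M x y = 1) (hadj : ∀ x y, G.Adj x y → 0 < M x y) (x : V) :
    Filter.Tendsto (fun t => avoidFrom M r t x) Filter.atTop (nhds 0) := by
  have hlim : ∀ x, ∃ g, Filter.Tendsto (fun t => avoidFrom M r t x) Filter.atTop (nhds g) :=
    fun x => ⟨_, tendsto_atTop_ciInf
      (antitone_nat_of_succ_le fun t => avoidFrom_succ_le hM hrow t x)
      ⟨0, by rintro _ ⟨t, rfl⟩; exact avoidFrom_nonneg hM t x⟩⟩
  choose g hg using hlim
  have hg0 : ∀ x, 0 ≤ g x := fun x => ge_of_tendsto' (hg x) fun t => avoidFrom_nonneg hM t x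
  have hgr : g r = 0 := by
    refine tendsto_nhds_unique (hg r) ?_
    simp only [avoidFrom_self]
    exact tendsto_const_nhds
  have hharm : ∀ x, x ≠ r → g x = ∑ y, M x y * g y := fun x hx => by
    refine tendsto_nhds_unique ((Filter.tendsto_add_atTop_iff_nat 1).2 (hg x)) ?_
    simp only [avoidFrom, hx, if_false]
    exact tendsto_finsetSum _ fun y _ => (hg y).const_mul _
  have : Nonempty V := ⟨r⟩
  obtain ⟨a, -, ha⟩ := Finset.exists_max_image Finset.univ g Finset.univ_nonempty
  have ha := fun y => ha y (Finset.mem_univ y)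
  have hga : g a ≤ 0 := by
    by_contra hpos
    push Not at hpos
    have hnb : ∀ x y, G.Adj x y → g x = g a → g y = g a := by
      intro x y hxy hx
      have hxr : x ≠ r := by rintro rfl; rw [hgr] at hx; linarith
      have hz : ∑ z, M x z * (g a - g z) = 0 := by
        simp only [mul_sub, Finset.sum_sub_distrib, ← Finset.sum_mul, hrow, one_mul]
        rw [← hharm x hxr, hx, sub_self]
      have := (Finset.sum_eq_zero_iff_of_nonneg fun z _ =>
        mul_nonneg (hM x z) (sub_nonneg.2 (ha z))).1 hz y (Finset.mem_univ y)
      rcases mul_eq_zero.1 this with h | h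
      · exact absurd h (hadj x y hxy).ne'
      · linarith
    have hall : ∀ y, g y = g a := by
      intro y
      obtain ⟨p⟩ := hG.preconnected a y
      have : ∀ (b y : V), G.Walk b y → g b = g a → g y = g a := by
        intro b y p
        induction p with
        | nil => exact id
        | cons h p ih => exact fun hb => ih (hnb _ _ h hb)
      exact this a y p rfl
    have := hall r
    rw [hgr] at this
    linarith
  have hgx : g x = 0 := le_antisymm ((ha x).trans hga) (hg0 x)
  exact hgx ▸ hg x

end kac

/-! ### Recurrence and the first return time -/

section returns

variable {V : Type*} {r : V}

/-- The return times of a path. -/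
noncomputable def returns (r : V) (x : ℕ → V) : ℕ → ℕ := Nat.nth fun t => x t = r

/-- The path starts at `r` and visits `r` infinitely often. -/
def Recurrent (r : V) (x : ℕ → V) : Prop := x 0 = r ∧ {t | x t = r}.Infinite

theorem Recurrent.strictMono {x : ℕ → V} (hx : Recurrent r x) : StrictMono (returns r x) :=
  Nat.nth_strictMono hx.2

theorem Recurrent.apply_returns {x : ℕ → V} (hx : Recurrent r x) (i : ℕ) :
    x (returns r x i) = r :=
  Nat.nth_mem_of_infinite hx.2 i

theorem Recurrent.returns_zero {x : ℕ → V} (hx : Recurrent r x) : returns r x 0 = 0 :=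
  Nat.nth_zero_of_zero hx.1

theorem exists_returns_eq {x : ℕ → V} {t : ℕ} (ht : x t = r) : ∃ i, returns r x i = t := by
  classical
  exact ⟨_, Nat.nth_count (p := fun t => x t = r) ht⟩

/-- A return is identified by counting the visits before it, so `y` need not be recurrent. -/
theorem Recurrent.returns_eq_of_agree {x y : ℕ → V} (hx : Recurrent r x) {t i : ℕ}
    (hxy : ∀ s ≤ t, x s = y s) (hi : returns r x i ≤ t) : returns r y i = returns r x i := by
  classical
  have h1 : y (returns r x i) = r := by rw [← hxy _ hi]; exact hx.apply_returns i
  have h2 : Nat.count (fun t => y t = r) (returns r x i) = i := by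
    have h3 : Nat.count (fun t => x t = r) (returns r x i) = i :=
      Nat.count_nth_of_infinite hx.2 i
    conv_rhs => rw [← h3]
    rw [Nat.count_eq_card_filter_range, Nat.count_eq_card_filter_range]
    congr 1
    refine Finset.filter_congr fun s hs => ?_
    rw [hxy s ((Finset.mem_range.1 hs).le.trans hi)]
  have := Nat.nth_count (p := fun t => y t = r) h1
  rwa [h2] at this

theorem Recurrent.returns_shiftPath {x : ℕ → V} (hx : Recurrent r x) (i : ℕ) :
    returns r (shiftPath (returns r x i) x) = restart (returns r x) i := by
  classical
  have hinf : {s | shiftPath (returns r x i) x s = r}.Infinite := by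
    refine Set.infinite_of_not_bddAbove fun ⟨b, hb⟩ => ?_
    obtain ⟨t, ht, hlt⟩ := hx.2.exists_gt (returns r x i + b)
    have := hb (show t - returns r x i ∈ {s | shiftPath (returns r x i) x s = r} by
      simp only [shiftPath, Set.mem_ofPred_eq]
      rwa [Nat.add_sub_cancel' (by omega)])
    omega
  funext j
  have h1 : x (returns r x i + returns r (shiftPath (returns r x i) x) j) = r :=
    Nat.nth_mem_of_infinite hinf j
  have h2 : Nat.count (fun t => x t = r)
      (returns r x i + returns r (shiftPath (returns r x i) x) j) = i + j := by
    rw [Nat.count_add]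
    exact congrArg₂ _ (Nat.count_nth_of_infinite hx.2 i) (Nat.count_nth_of_infinite hinf j)
  have h3 := Nat.nth_count (p := fun t => x t = r) h1
  rw [h2] at h3
  change returns r x (i + j) = _ at h3
  rw [restart, h3]
  omega

theorem Recurrent.lt_returns_one {x : ℕ → V} (hx : Recurrent r x) (t : ℕ) :
    t < returns r x 1 ↔ ∀ s, 1 ≤ s → s ≤ t → x s ≠ r := by
  constructor
  · intro ht s h1 h2 hs
    obtain ⟨i, rfl⟩ := exists_returns_eq hs
    have h3 : i < 1 := hx.strictMono.lt_iff_lt.1 (by omega)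
    obtain rfl : i = 0 := by omega
    rw [hx.returns_zero] at h1
    omega
  · intro h
    by_contra hlt
    refine h (returns r x 1) ?_ (by omega) (hx.apply_returns 1)
    have := hx.strictMono (show 0 < 1 by omega)
    omega

/-- The paths that do not visit `r` at the times `1, …, t`. -/
def avoidSet (r : V) (t : ℕ) : Set (ℕ → V) := {x | ∀ s, 1 ≤ s → s ≤ t → x s ≠ r}

theorem determinedAt_avoidSet (r : V) (t : ℕ) : DeterminedAt t (avoidSet r t) :=
  fun x y h hx s h1 h2 => by rw [← h s h2]; exact hx s h1 h2

variable [Fintype V] [MeasurableSpace V] [MeasurableSingletonClass V]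
  [DecidableEq V] {G : SimpleGraph V} [DecidableRel G.Adj]
  {P : Measure (ℕ → V)} [IsProbabilityMeasure P]

theorem IsLazyWalk.measureReal_avoidSet_inter (hP : IsLazyWalk G r P fun t x => x t) (t : ℕ)
    (y : V) : P.real (avoidSet r t ∩ {x | x t = y}) = avoidTo (lazyMatrix G) r t y := by
  induction t generalizing y with
  | zero =>
    have : avoidSet r 0 = Set.univ := by
      ext x; simp only [avoidSet, Set.mem_ofPred_eq, Set.mem_univ, iff_true]; intros; omega
    rw [this, Set.univ_inter, hP.measureReal_coord, avoidTo, pow_zero, Matrix.one_apply]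
    simp [eq_comm]
  | succ t ih =>
    rw [avoidTo]
    split_ifs with hy
    · have : avoidSet r (t + 1) ∩ {x | x (t + 1) = y} = ∅ := by
        rw [Set.eq_empty_iff_forall_notMem]
        rintro x ⟨hx, hx'⟩
        exact hx (t + 1) (by omega) le_rfl (hy ▸ hx')
      simp [this]
    · rw [← sum_measureReal_inter_preimage P (measurable_pi_apply t)]
      refine Finset.sum_congr rfl fun a _ => ?_
      rw [← ih, ← hP.one_step (determinedAt_avoidSet r t)]
      congr 1
      ext x
      constructor
      · rintro ⟨⟨h1, h2⟩, h3⟩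
        exact ⟨fun s hs hs' => h1 s hs (by omega), h3, h2⟩
      · rintro ⟨h1, h3, h2⟩
        refine ⟨⟨fun s hs hs' => ?_, h2⟩, h3⟩
        rcases Nat.lt_or_ge t s with h | h
        · obtain rfl : s = t + 1 := by omega
          rw [h2]; exact hy
        · exact h1 s hs h

theorem IsLazyWalk.measureReal_avoidSet (hP : IsLazyWalk G r P fun t x => x t) (t : ℕ) :
    P.real (avoidSet r t) = ∑ y, avoidTo (lazyMatrix G) r t y := by
  rw [← sum_measureReal_inter_preimage P (measurable_pi_apply t)]
  exact Finset.sum_congr rfl fun y _ => hP.measureReal_avoidSet_inter t y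

/-- The terms are the probabilities of no return by time t. Their convergence to 0 will give
recurrence, and their sum the mean return time. -/
theorem IsLazyWalk.hasSum_avoidSet (hP : IsLazyWalk G r P fun t x => x t) (hG : G.Connected)
    {d : ℕ} (hd : ∀ x, G.degree x = d) (hd0 : 0 < d) :
    HasSum (fun t => P.real (avoidSet r t)) (Fintype.card V) := by
  rw [hasSum_iff_tendsto_nat_of_nonneg fun t => measureReal_nonneg]
  refine (Filter.tendsto_add_atTop_iff_nat 1).1 ?_
  have hcol : ∀ y, ∑ x, lazyMatrix G x y = 1 := fun y => by
    rw [← lazyMatrix_row_sum hd hd0 y]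
    exact Finset.sum_congr rfl fun x _ => lazyMatrix_symm hd x y
  simp only [hP.measureReal_avoidSet, sum_range_sum_avoidTo hcol]
  have hadj : ∀ x y, G.Adj x y → 0 < lazyMatrix G x y := fun x y h => by
    have : (0 : ℝ) < d := by exact_mod_cast hd0
    rw [lazyMatrix_apply, hd, if_pos h, if_neg h.ne]
    positivity
  have h := tendsto_finsetSum Finset.univ fun x _ =>
    tendsto_avoidFrom (r := r) hG lazyMatrix_nonneg (lazyMatrix_row_sum hd hd0) hadj x
  simpa using h.const_sub (Fintype.card V : ℝ)

theorem IsLazyWalk.ae_recurrent (hP : IsLazyWalk G r P fun t x => x t) (hG : G.Connected)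
    {d : ℕ} (hd : ∀ x, G.degree x = d) (hd0 : 0 < d) : ∀ᵐ x ∂P, Recurrent r x := by
  have h0 : ∀ᵐ x ∂P, x 0 = r := by
    have h1 := hP.measureReal_coord 0 r
    rw [pow_zero, Matrix.one_apply_eq] at h1
    rw [Measure.real, ENNReal.toReal_eq_one_iff] at h1
    exact (mem_ae_iff_prob_eq_one (measurableSet_coord 0 r)).2 h1
  have htend := (hP.hasSum_avoidSet hG hd hd0).summable.tendsto_atTop_zero
  -- A last visit at time t forces the restarted walk to avoid `r` up to every time N, and the
  -- probability of that tends to 0.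
  have hnone : ∀ t, ∀ᵐ x ∂P, ¬ (x t = r ∧ ∀ s, 1 ≤ s → x (t + s) ≠ r) := by
    intro t
    rw [ae_iff]
    simp only [not_not]
    have hle : ∀ N, P.real {x | x t = r ∧ ∀ s, 1 ≤ s → x (t + s) ≠ r} ≤
        P.real (avoidSet r N) := by
      intro N
      have hdet : DeterminedAt t {x : ℕ → V | x t = r} := fun x y h hx => by
        change y t = r; rw [← h t le_rfl]; exact hx
      have hm := hP.markov (B := avoidSet r N) hdet (fun x hx => hx)
        (determinedAt_avoidSet r N).measurableSet.nullMeasurableSet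
      refine ENNReal.toReal_mono (measure_ne_top _ _) ?_
      calc P {x | x t = r ∧ ∀ s, 1 ≤ s → x (t + s) ≠ r}
          ≤ P ({x | x t = r} ∩ shiftPath t ⁻¹' avoidSet r N) :=
            measure_mono fun x hx => ⟨hx.1, fun s hs _ => hx.2 s hs⟩
        _ = P {x | x t = r} * P (avoidSet r N) := hm
        _ ≤ 1 * P (avoidSet r N) := by gcongr; exact prob_le_one
        _ = _ := one_mul _
    have := ge_of_tendsto' htend hle
    exact (measureReal_eq_zero_iff).1 (le_antisymm this measureReal_nonneg)
  filter_upwards [h0, ae_all_iff.2 hnone] with x hx0 hx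
  refine ⟨hx0, fun hfin => ?_⟩
  obtain ⟨t, ht, hmax⟩ := hfin.exists_maximal ⟨0, hx0⟩
  refine hx t ⟨ht, fun s hs hts => ?_⟩
  have := hmax (show x (t + s) = r from hts) (by simp)
  omega

/-- The tail-sum formula: T₁ is the sum over t of the indicators of t < T₁. -/
theorem IsLazyWalk.lintegral_returns_one (hP : IsLazyWalk G r P fun t x => x t)
    (hG : G.Connected) {d : ℕ} (hd : ∀ x, G.degree x = d) (hd0 : 0 < d) :
    AEMeasurable (fun x => (returns r x 1 : ENNReal)) P ∧
      ∫⁻ x, (returns r x 1 : ENNReal) ∂P = Fintype.card V := by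
  have hmeas : ∀ t, Measurable ((avoidSet r t).indicator fun _ : ℕ → V => (1 : ENNReal)) :=
    fun t => measurable_const.indicator (determinedAt_avoidSet r t).measurableSet
  have hae : (fun x => (returns r x 1 : ENNReal)) =ᵐ[P]
      fun x => ∑' t, (avoidSet r t).indicator (fun _ => (1 : ENNReal)) x := by
    filter_upwards [hP.ae_recurrent hG hd hd0] with x hx
    have h1 : ∀ t, (avoidSet r t).indicator (fun _ => (1 : ENNReal)) x =
        if t < returns r x 1 then 1 else 0 := fun t => by
      by_cases h : t < returns r x 1
      · rw [if_pos h, Set.indicator_of_mem]; exact (hx.lt_returns_one t).1 h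
      · rw [if_neg h, Set.indicator_of_notMem]; exact fun h' => h ((hx.lt_returns_one t).2 h')
    simp only [h1]
    rw [tsum_eq_sum (s := Finset.range (returns r x 1)) fun t ht => by
      simpa using ht]
    rw [Finset.sum_congr rfl fun t ht => if_pos (Finset.mem_range.1 ht)]
    simp
  refine ⟨⟨_, Measurable.tsum hmeas, hae⟩, ?_⟩
  rw [lintegral_congr_ae hae, lintegral_tsum fun t => (hmeas t).aemeasurable]
  simp only [lintegral_indicator_const (determinedAt_avoidSet r _).measurableSet, one_mul]
  have hs := hP.hasSum_avoidSet hG hd hd0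
  have h2 : ∀ t, P (avoidSet r t) = ENNReal.ofReal (P.real (avoidSet r t)) := fun t =>
    (ofReal_measureReal).symm
  simp only [h2]
  rw [← ENNReal.ofReal_tsum_of_nonneg (fun t => measureReal_nonneg) hs.summable, hs.tsum_eq,
    ENNReal.ofReal_natCast]

end returns

/-! ### The strong Markov property at an observed return -/

section strongMarkov

/-- An observer who has seen the returns with index up to `I` knows `I` and whether the return
time sequence belongs to `A`. -/
def Observed (I : (ℕ → ℕ) → ℕ) (A : Set (ℕ → ℕ)) : Prop :=
  ∀ T T' : ℕ → ℕ, StrictMono T → (∀ i ≤ I T, T' i = T i) → I T' = I T ∧ (T' ∈ A ↔ T ∈ A)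

theorem Observed.compl {I : (ℕ → ℕ) → ℕ} {A : Set (ℕ → ℕ)} (h : Observed I A) :
    Observed I Aᶜ :=
  fun T T' hT hTT' => ⟨(h T T' hT hTT').1, not_congr (h T T' hT hTT').2⟩

variable {V : Type*} {r : V}

/-- The paths for which, as far as can be seen at time `t`, the observation governed by `I` ends
at time `t` and the return times belong to `A`. -/
def stopSet (r : V) (I : (ℕ → ℕ) → ℕ) (A : Set (ℕ → ℕ)) (t : ℕ) : Set (ℕ → V) :=
  {x | ∃ y, Recurrent r y ∧ (∀ s ≤ t, y s = x s) ∧ returns r y ∈ A ∧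
    returns r y (I (returns r y)) = t}

/-- The recurrent witness in `stopSet` only has to agree with the path up to time t, so this holds
for all paths, recurrent or not. -/
theorem determinedAt_stopSet (I : (ℕ → ℕ) → ℕ) (A : Set (ℕ → ℕ)) (t : ℕ) :
    DeterminedAt t (stopSet r I A t) := by
  rintro x x' h ⟨y, hy, hyx, hA, hI⟩
  exact ⟨y, hy, fun s hs => (hyx s hs).trans (h s hs), hA, hI⟩

theorem apply_of_mem_stopSet {I : (ℕ → ℕ) → ℕ} {A : Set (ℕ → ℕ)} {t : ℕ} {x : ℕ → V}
    (hx : x ∈ stopSet r I A t) : x t = r := by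
  obtain ⟨y, hy, hyx, -, hI⟩ := hx
  rw [← hyx t le_rfl, ← hI]
  exact hy.apply_returns _

theorem Observed.mem_stopSet_iff {I : (ℕ → ℕ) → ℕ} {A : Set (ℕ → ℕ)} (h : Observed I A) {t : ℕ}
    {x : ℕ → V} (hx : Recurrent r x) :
    x ∈ stopSet r I A t ↔ returns r x ∈ A ∧ returns r x (I (returns r x)) = t := by
  constructor
  · rintro ⟨y, hy, hyx, hA, hI⟩
    have hag : ∀ i ≤ I (returns r y), returns r x i = returns r y i := fun i hi =>
      hy.returns_eq_of_agree hyx ((hy.strictMono.monotone hi).trans hI.le)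
    obtain ⟨h1, h2⟩ := h _ _ hy.strictMono hag
    exact ⟨h2.2 hA, by rw [h1, hag _ le_rfl, hI]⟩
  · rintro ⟨hA, hI⟩
    exact ⟨x, hx, fun _ _ => rfl, hA, hI⟩

variable [Fintype V] [MeasurableSpace V] [MeasurableSingletonClass V]
  [DecidableEq V] {G : SimpleGraph V} [DecidableRel G.Adj]
  {P : Measure (ℕ → V)} [IsProbabilityMeasure P]

theorem Observed.ae_eq_iUnion_stopSet {I : (ℕ → ℕ) → ℕ} {A : Set (ℕ → ℕ)} (h : Observed I A)
    (hR : ∀ᵐ x ∂P, Recurrent r x) :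
    {x | returns r x ∈ A} =ᵐ[P] ⋃ t, stopSet r I A t := by
  filter_upwards [hR] with x hx
  refine propext (Iff.trans ?_ Set.mem_iUnion.symm)
  simp only [h.mem_stopSet_iff hx]
  exact ⟨fun h => ⟨_, h, rfl⟩, fun ⟨_, h, _⟩ => h⟩

theorem Observed.nullMeasurableSet {I : (ℕ → ℕ) → ℕ} {A : Set (ℕ → ℕ)} (h : Observed I A)
    (hR : ∀ᵐ x ∂P, Recurrent r x) : NullMeasurableSet {x | returns r x ∈ A} P :=
  (MeasurableSet.iUnion fun t =>
    (determinedAt_stopSet I A t).measurableSet).nullMeasurableSet.congr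
    (h.ae_eq_iUnion_stopSet hR).symm

/-- Decompose by the time t of the return at which the observation stops. The pieces are almost
surely disjoint, each is determined at t and at `r` at that time, and `IsLazyWalk.markov` applies to
each. -/
theorem IsLazyWalk.strong_markov (hP : IsLazyWalk G r P fun t x => x t)
    (hR : ∀ᵐ x ∂P, Recurrent r x) {I : (ℕ → ℕ) → ℕ} {A B : Set (ℕ → ℕ)} (hA : Observed I A)
    (hB : NullMeasurableSet {x | returns r x ∈ B} P) :
    P {x | returns r x ∈ A ∧ restart (returns r x) (I (returns r x)) ∈ B} =
      P {x | returns r x ∈ A} * P {x | returns r x ∈ B} := by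
  have hdisj : Pairwise (Function.onFun (AEDisjoint P) (stopSet r I A)) := by
    intro s t hst
    have : ∀ᵐ x ∂P, ¬ x ∈ stopSet r I A s ∩ stopSet r I A t := by
      filter_upwards [hR] with x hx
      rintro ⟨h1, h2⟩
      rw [hA.mem_stopSet_iff hx] at h1 h2
      exact hst (h1.2.symm.trans h2.2)
    change P (stopSet r I A s ∩ stopSet r I A t) = 0
    simpa [ae_iff] using this
  have hae : ({x | returns r x ∈ A ∧ restart (returns r x) (I (returns r x)) ∈ B} :
      Set (ℕ → V)) =ᵐ[P]
      ⋃ t, (stopSet r I A t ∩ shiftPath t ⁻¹' {x | returns r x ∈ B}) := by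
    filter_upwards [hR] with x hx
    refine propext (Iff.trans ?_ Set.mem_iUnion.symm)
    simp only [Set.mem_inter_iff, hA.mem_stopSet_iff hx, Set.mem_preimage, Set.mem_ofPred_eq]
    constructor
    · rintro ⟨h1, h2⟩
      exact ⟨_, ⟨h1, rfl⟩, by rwa [hx.returns_shiftPath]⟩
    · rintro ⟨t, ⟨h1, rfl⟩, h2⟩
      rw [hx.returns_shiftPath] at h2
      exact ⟨h1, h2⟩
  have hnull : ∀ t, NullMeasurableSet
      (stopSet r I A t ∩ shiftPath t ⁻¹' {x | returns r x ∈ B}) P := by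
    intro t
    have hdet := determinedAt_stopSet (r := r) I A t
    have hq : Measure.QuasiMeasurePreserving (shiftPath t) (P.restrict (stopSet r I A t)) P := by
      refine ⟨measurable_shiftPath t, ?_⟩
      rw [hP.map_shiftPath hdet fun x hx => apply_of_mem_stopSet hx]
      exact Measure.smul_absolutelyContinuous
    have := hB.preimage hq
    rwa [nullMeasurableSet_restrict hdet.measurableSet.nullMeasurableSet, Set.inter_comm] at this
  rw [measure_congr hae, measure_congr (hA.ae_eq_iUnion_stopSet hR), measure_iUnion₀ _ hnull,
    measure_iUnion₀ hdisj fun t => (determinedAt_stopSet I A t).measurableSet.nullMeasurableSet,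
    ← ENNReal.tsum_mul_right]
  · refine tsum_congr fun t => ?_
    exact hP.markov (determinedAt_stopSet I A t) (fun x hx => apply_of_mem_stopSet hx) hB
  · intro s t hst
    exact (hdisj hst).mono Set.inter_subset_left Set.inter_subset_left

end strongMarkov

/-! ### The distribution of the estimates -/

section estimates

theorem observed_success (m : ℕ) : Observed (fun T => experimentEnd T m 0)
    {T | T (experimentEnd T m 0) = T 0 + m} := by
  intro T T' hT h
  have h1 := experimentEnd_congr hT h
  refine ⟨h1, ?_⟩
  simp only [Set.mem_ofPred_eq]
  rw [h1, h _ le_rfl, h 0 (Nat.zero_le _)]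

theorem observed_successCount (N m : ℕ) (S : Set ℕ) :
    Observed (fun T => experimentIndex T m 0 N) {T | successCount N T m 0 ∈ S} := by
  intro T T' hT h
  refine ⟨experimentIndex_congr hT h, ?_⟩
  simp only [Set.mem_ofPred_eq]
  rw [successCount_congr hT h]

variable {V : Type*} {r : V}

/-- Success means that `m` is itself a return time, which is why one experiment succeeds with
probability P_m(r,r). -/
theorem Recurrent.success_iff {x : ℕ → V} (hx : Recurrent r x) (m : ℕ) :
    returns r x (experimentEnd (returns r x) m 0) = returns r x 0 + m ↔ x m = r := by
  have hT := hx.strictMono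
  rw [hx.returns_zero, zero_add]
  constructor
  · intro h
    have := hx.apply_returns (experimentEnd (returns r x) m 0)
    rwa [h] at this
  · intro h
    obtain ⟨j, hj⟩ := exists_returns_eq h
    have h1 := (experimentEnd_spec hT m 0).2
    rw [hx.returns_zero, zero_add] at h1
    have h2 : experimentEnd (returns r x) m 0 ≤ j :=
      Nat.sInf_le ⟨Nat.zero_le _, by rw [hx.returns_zero, zero_add, hj]⟩
    exact le_antisymm ((hT.monotone h2).trans hj.le) h1

variable [Fintype V] [MeasurableSpace V] [MeasurableSingletonClass V]
  [DecidableEq V] {G : SimpleGraph V} [DecidableRel G.Adj]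
  {P : Measure (ℕ → V)} [IsProbabilityMeasure P]

theorem measureReal_union_eq_add_of_disjoint_split {α : Type*} [MeasurableSpace α]
    {ν : Measure α} [IsFiniteMeasure ν] {S A B : Set α} (hS : NullMeasurableSet S ν)
    (hA : A ⊆ S) (hB : B ⊆ Sᶜ) : ν.real (A ∪ B) = ν.real A + ν.real B := by
  rw [← measureReal_inter_add_sdiff₀ (s := A ∪ B) hS]
  congr 2
  · ext x
    exact ⟨fun h => h.1.resolve_right fun hb => hB hb h.2, fun h => ⟨Or.inl h, hA h⟩⟩
  · ext x
    exact ⟨fun h => h.1.resolve_left fun ha => h.2 (hA ha), fun h => ⟨Or.inr h, hB h⟩⟩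

/-- The number of successes in `N` experiments has a binomial distribution. -/
theorem IsLazyWalk.measureReal_successCount (hP : IsLazyWalk G r P fun t x => x t)
    (hR : ∀ᵐ x ∂P, Recurrent r x) (m N k : ℕ) :
    P.real {x | successCount N (returns r x) m 0 = k} =
      N.choose k * (lazyMatrix G ^ m) r r ^ k * (1 - (lazyMatrix G ^ m) r r) ^ (N - k) := by
  set p := (lazyMatrix G ^ m) r r with hp
  have hnull : ∀ N k, NullMeasurableSet {x | returns r x ∈ {T | successCount N T m 0 = k}} P :=
    fun N k => (observed_successCount N m {k}).nullMeasurableSet hR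
  have hsucc : P.real {x | returns r x ∈ {T | T (experimentEnd T m 0) = T 0 + m}} = p := by
    rw [hp, ← hP.measureReal_coord]
    refine measureReal_congr ?_
    filter_upwards [hR] with x hx
    exact propext (hx.success_iff m)
  have hfail : P.real {x | returns r x ∈ {T | T (experimentEnd T m 0) = T 0 + m}ᶜ} = 1 - p := by
    rw [← hsucc]
    exact probReal_compl_eq_one_sub₀ ((observed_success m).nullMeasurableSet hR)
  have hmul : ∀ (A : Set (ℕ → ℕ)), Observed (fun T => experimentEnd T m 0) A → ∀ N k,
      P.real {x | returns r x ∈ A ∧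
        restart (returns r x) (experimentEnd (returns r x) m 0) ∈
          {T | successCount N T m 0 = k}} =
      P.real {x | returns r x ∈ A} * P.real {x | successCount N (returns r x) m 0 = k} := by
    intro A hA N k
    rw [measureReal_def, hP.strong_markov hR hA (hnull N k), ENNReal.toReal_mul]
    rfl
  induction N generalizing k with
  | zero =>
    cases k with
    | zero => simp [successCount]
    | succ k => simp [successCount]
  | succ N ih =>
    -- The first experiment succeeds or fails, and by the strong Markov property the other `N` are
    -- independent of it; the recursion is Pascal's.
    have hS := hmul _ (observed_success m) N
    have hF := hmul _ (observed_success m).compl N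
    simp only [hsucc, hfail, ih] at hS hF
    cases k with
    | zero =>
      have h1 : ({x | successCount (N + 1) (returns r x) m 0 = 0} : Set (ℕ → V)) =ᵐ[P]
          {x | returns r x ∈ {T | T (experimentEnd T m 0) = T 0 + m}ᶜ ∧
            restart (returns r x) (experimentEnd (returns r x) m 0) ∈
            {T | successCount N T m 0 = 0}} := by
        refine Filter.eventuallyEq_set.2 ?_
        filter_upwards [hR] with x hx
        simp only [Set.mem_ofPred_eq, Set.mem_compl_iff]
        rw [successCount_restart hx.strictMono, successCount_succ]
        split_ifs with h <;> simp [h]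
      rw [measureReal_congr h1, hF]
      simp [pow_succ]
      ring
    | succ k =>
      have h1 : ({x | successCount (N + 1) (returns r x) m 0 = k + 1} : Set (ℕ → V)) =ᵐ[P]
          ({x | returns r x ∈ {T | T (experimentEnd T m 0) = T 0 + m} ∧
            restart (returns r x) (experimentEnd (returns r x) m 0) ∈
            {T | successCount N T m 0 = k}} ∪
          {x | returns r x ∈ {T | T (experimentEnd T m 0) = T 0 + m}ᶜ ∧
            restart (returns r x) (experimentEnd (returns r x) m 0) ∈
            {T | successCount N T m 0 = k + 1}} : Set (ℕ → V)) := by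
        refine Filter.eventuallyEq_set.2 ?_
        filter_upwards [hR] with x hx
        simp only [Set.mem_union, Set.mem_ofPred_eq, Set.mem_compl_iff]
        rw [successCount_restart hx.strictMono, successCount_succ]
        split_ifs with h <;> simp [h]
      rw [measureReal_congr h1, measureReal_union_eq_add_of_disjoint_split
        ((observed_success m).nullMeasurableSet hR) (fun x hx => hx.1) (fun x hx => hx.1), hS, hF,
        Nat.choose_succ_succ]
      -- For k ≥ N the truncated exponent N - (k + 1) is harmless, since its binomial coefficient
      -- vanishes.
      rcases Nat.lt_or_ge k N with h | h
      · have e1 : N + 1 - (k + 1) = N - (k + 1) + 1 := by omega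
        have e2 : N - k = N - (k + 1) + 1 := by omega
        rw [e1, e2]
        push_cast
        ring
      · rw [Nat.choose_eq_zero_of_lt (show N < k + 1 by omega)]
        have e1 : N + 1 - (k + 1) = N - k := by omega
        rw [e1]
        push_cast
        ring

/-- The variance identity for Bernstein polynomials, evaluated at `p`. -/
theorem sum_binomial_variance (N : ℕ) (p : ℝ) :
    ∑ k ∈ Finset.range (N + 1), (N * p - k) ^ 2 * (N.choose k * p ^ k * (1 - p) ^ (N - k)) =
      N * p * (1 - p) := by
  have h := congrArg (Polynomial.eval p) (bernsteinPolynomial.variance ℝ N)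
  simpa [Polynomial.eval_finsetSum, bernsteinPolynomial] using h

/-- Chebyshev's inequality for one estimate. -/
theorem IsLazyWalk.measureReal_estimate (hP : IsLazyWalk G r P fun t x => x t)
    (hR : ∀ᵐ x ∂P, Recurrent r x) (m : ℕ) {N : ℕ} (hN : 0 < N) {η : ℝ} (hη : 0 < η) :
    P.real {x | η ≤ |excess G r m - estimate (Fintype.card V) N (returns r x) m 0|} ≤
      1 / (4 * N * η ^ 2) := by
  set p := (lazyMatrix G ^ m) r r with hp
  have hN' : (0 : ℝ) < N := by exact_mod_cast hN
  have hp01 : 0 ≤ p ∧ p ≤ 1 := by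
    rw [hp, ← hP.measureReal_coord]
    exact ⟨measureReal_nonneg, measureReal_le_one⟩
  set W : Finset ℕ := (Finset.range (N + 1)).filter fun k : ℕ => η ≤ |p - (k : ℝ) / N| with hW
  have hsub : {x | η ≤ |excess G r m - estimate (Fintype.card V) N (returns r x) m 0|} ⊆
      ⋃ k ∈ W, {x | successCount N (returns r x) m 0 = k} := by
    intro x hx
    simp only [Set.mem_iUnion]
    refine ⟨successCount N (returns r x) m 0, ?_, rfl⟩
    rw [hW, Finset.mem_filter, Finset.mem_range, Nat.lt_succ_iff]
    refine ⟨(Finset.card_filter_le _ _).trans (Finset.card_range N).le, ?_⟩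
    have hx : η ≤ |excess G r m - estimate (Fintype.card V) N (returns r x) m 0| := hx
    rwa [estimate_eq, excess, sub_sub_sub_cancel_right] at hx
  calc P.real {x | η ≤ |excess G r m - estimate (Fintype.card V) N (returns r x) m 0|}
      ≤ P.real (⋃ k ∈ W, {x | successCount N (returns r x) m 0 = k}) :=
        measureReal_mono hsub (measure_ne_top _ _)
    _ ≤ ∑ k ∈ W, P.real {x | successCount N (returns r x) m 0 = k} :=
        measureReal_biUnion_finset_le _ _
    _ ≤ ∑ k ∈ W, 1 / (N ^ 2 * η ^ 2) *
          ((N * p - k) ^ 2 * (N.choose k * p ^ k * (1 - p) ^ (N - k))) := by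
        refine Finset.sum_le_sum fun k hk => ?_
        rw [hP.measureReal_successCount hR, ← hp, ← mul_assoc]
        have hb : 0 ≤ N.choose k * p ^ k * (1 - p) ^ (N - k) := by
          have := sub_nonneg.2 hp01.2
          have := hp01.1
          positivity
        refine le_mul_of_one_le_left hb ?_
        rw [one_div, ← div_eq_inv_mul, one_le_div (by positivity)]
        have h1 := (Finset.mem_filter.1 hk).2
        have h2 : N * p - k = N * (p - k / N) := by field_simp
        rw [h2, mul_pow, ← sq_abs (p - k / N)]
        gcongr
    _ ≤ ∑ k ∈ Finset.range (N + 1), 1 / (N ^ 2 * η ^ 2) *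
          ((N * p - k) ^ 2 * (N.choose k * p ^ k * (1 - p) ^ (N - k))) := by
        refine Finset.sum_le_sum_of_subset_of_nonneg (Finset.filter_subset _ _) fun k _ _ => ?_
        have := sub_nonneg.2 hp01.2
        have := hp01.1
        positivity
    _ = 1 / (N * η ^ 2) * (p * (1 - p)) := by
        rw [← Finset.mul_sum, sum_binomial_variance]
        field_simp
    _ ≤ 1 / (N * η ^ 2) * (1 / 4) := by
        gcongr
        nlinarith [sq_nonneg (p - 1 / 2)]
    _ = 1 / (4 * N * η ^ 2) := by field_simp

/-- The `j`-th halving is unlikely to use a bad estimate. -/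
theorem IsLazyWalk.measureReal_searchAt (hP : IsLazyWalk G r P fun t x => x t)
    (hR : ∀ᵐ x ∂P, Recurrent r x) (c ε δ : ℝ) (hN : 0 < sampleSize (Fintype.card V) c ε δ)
    {η : ℝ} (hη : 0 < η) (j : ℕ) :
    P.real {x | ∃ s, s = searchAt (Fintype.card V) c ε δ (returns r x) j ∧ s.lo + 1 < s.hi ∧
      η ≤ |excess G r ((s.lo + s.hi) / 2) -
        estimate (Fintype.card V) (sampleSize (Fintype.card V) c ε δ) (returns r x)
          ((s.lo + s.hi) / 2) s.used|} ≤
      1 / (4 * sampleSize (Fintype.card V) c ε δ * η ^ 2) := by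
  set n := Fintype.card V with hn
  set N := sampleSize n c ε δ with hNdef
  set I : (ℕ → ℕ) → ℕ := fun T => (searchAt n c ε δ T j).used with hI
  -- The midpoint is random but known before its experiments begin. Conditioning on its value makes
  -- `m` fixed, and since these events are disjoint, summing over `m` costs no factor.
  set A : ℕ → Set (ℕ → ℕ) := fun m => {T | (searchAt n c ε δ T j).lo + 1 <
    (searchAt n c ε δ T j).hi ∧
    ((searchAt n c ε δ T j).lo + (searchAt n c ε δ T j).hi) / 2 = m} with hA
  set B : ℕ → Set (ℕ → ℕ) := fun m => {T | η ≤ |excess G r m - estimate n N T m 0|} with hB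
  have hobsA : ∀ m, Observed I (A m) := fun m T T' hT h => by
    have := searchAt_congr n c ε δ hT j h
    simp only [hI, hA, Set.mem_ofPred_eq, this, and_self]
  have hobsB : ∀ m, Observed (fun T => experimentIndex T m 0 N) (B m) := fun m T T' hT h => by
    refine ⟨experimentIndex_congr hT h, ?_⟩
    simp only [hB, Set.mem_ofPred_eq]
    rw [estimate_congr hT h]
  have hnullA := fun m => (hobsA m).nullMeasurableSet hR
  have hnullB := fun m => (hobsB m).nullMeasurableSet hR
  set K := ⌊searchBound n c⌋₊
  have hBle : ∀ m, P {x | returns r x ∈ B m} ≤ ENNReal.ofReal (1 / (4 * N * η ^ 2)) := fun m => by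
    rw [← ofReal_measureReal]
    exact ENNReal.ofReal_le_ofReal (hP.measureReal_estimate hR m hN hη)
  have hdisj : Set.Pairwise (↑(Finset.range (K + 1)))
      (Function.onFun (AEDisjoint P) fun m => {x : ℕ → V | returns r x ∈ A m}) := by
    intro m _ m' _ hm
    refine Disjoint.aedisjoint (Set.disjoint_left.2 fun x hx hx' => hm ?_)
    exact hx.2.symm.trans hx'.2
  refine ENNReal.toReal_le_of_le_ofReal (by positivity) ?_
  calc P {x | ∃ s, s = searchAt n c ε δ (returns r x) j ∧ s.lo + 1 < s.hi ∧
      η ≤ |excess G r ((s.lo + s.hi) / 2) -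
        estimate n N (returns r x) ((s.lo + s.hi) / 2) s.used|}
      ≤ P (⋃ m ∈ Finset.range (K + 1), {x | returns r x ∈ A m ∧
          restart (returns r x) (I (returns r x)) ∈ B m}) := by
        refine measure_mono_ae ?_
        filter_upwards [hR] with x hx
        rintro ⟨s, rfl, h1, h2⟩
        refine Set.mem_iUnion₂.2 ⟨_, Finset.mem_range.2 (Nat.lt_succ_of_le ?_), ⟨h1, rfl⟩, ?_⟩
        · have := searchAt_bounds n c ε δ (returns r x) j
          omega
        · simp only [hB, Set.mem_ofPred_eq]
          rwa [estimate_eq, successCount_restart hx.strictMono, ← estimate_eq]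
    _ ≤ ∑ m ∈ Finset.range (K + 1), P {x | returns r x ∈ A m ∧
          restart (returns r x) (I (returns r x)) ∈ B m} := measure_biUnion_finset_le _ _
    _ ≤ ∑ m ∈ Finset.range (K + 1), P {x | returns r x ∈ A m} *
          ENNReal.ofReal (1 / (4 * N * η ^ 2)) := by
        refine Finset.sum_le_sum fun m _ => ?_
        rw [hP.strong_markov hR (hobsA m) (hnullB m)]
        gcongr
        exact hBle m
    _ = P (⋃ m ∈ Finset.range (K + 1), {x | returns r x ∈ A m}) *
          ENNReal.ofReal (1 / (4 * N * η ^ 2)) := by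
        rw [← Finset.sum_mul, measure_biUnion_finset₀ hdisj fun m _ => hnullA m]
    _ ≤ 1 * ENNReal.ofReal (1 / (4 * N * η ^ 2)) := by
        gcongr
        exact prob_le_one
    _ = _ := one_mul _

end estimates

/-! ### The parameters of the search -/

section parameters

variable {n : ℕ} {c ε δ : ℝ}

theorem two_le_searchBound (hn : 2 ≤ n) (hc : 3 ≤ c) : 2 ≤ searchBound n c := by
  have hn' : (2 : ℝ) ≤ n := by exact_mod_cast hn
  have hlog : 1 / 2 ≤ Real.log n :=
    le_trans (by linarith [Real.log_two_gt_d9]) (Real.log_le_log (by norm_num) hn')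
  unfold searchBound
  calc (2 : ℝ) ≤ 4 * 2 ^ 2 * (1 / 2) := by norm_num
    _ ≤ (c + 1) * (n : ℝ) ^ 2 * Real.log n := by gcongr; linarith

theorem one_le_logb_searchBound (hn : 2 ≤ n) (hc : 3 ≤ c) :
    1 ≤ Real.logb 2 (searchBound n c) := by
  have h := two_le_searchBound hn hc
  rw [Real.le_logb_iff_rpow_le (by norm_num) (by linarith), Real.rpow_one]
  exact h

theorem tolerance_pos (hn : 2 ≤ n) (hε : 0 < ε) : 0 < tolerance n c ε := by
  have hn' : (0 : ℝ) < n := by exact_mod_cast (by omega : 0 < n)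
  unfold tolerance
  positivity

theorem sampleSize_pos (hn : 2 ≤ n) (hc : 3 ≤ c) (hε : 0 < ε) (hδ : 0 < δ) :
    0 < sampleSize n c ε δ := by
  have h1 := tolerance_pos (c := c) hn hε
  have h2 := one_le_logb_searchBound hn hc
  unfold sampleSize
  rw [Nat.ceil_pos]
  have : 0 < Real.logb 2 (searchBound n c) := by linarith
  positivity

/-- The choice of N makes Nη² ≥ L/δ with L = log₂ K₀. The 4 from Chebyshev's inequality pays for
rounding the number of halvings and for the estimate at ⌊K₀⌋. -/
theorem failure_le (hn : 2 ≤ n) (hc : 3 ≤ c) (hε : 0 < ε) (hδ : 0 < δ) :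
    1 / (4 * sampleSize n c ε δ * tolerance n c ε ^ 2) ≤
      δ / (4 * Real.logb 2 (searchBound n c)) := by
  have h1 := tolerance_pos (c := c) hn hε
  have h2 := one_le_logb_searchBound hn hc
  have hN : (0 : ℝ) < sampleSize n c ε δ := by exact_mod_cast sampleSize_pos hn hc hε hδ
  set L := Real.logb 2 (searchBound n c) with hL
  have hL0 : 0 < L := by linarith
  have h3 : 1 / (tolerance n c ε ^ 2 * (δ / L)) ≤ sampleSize n c ε δ := Nat.le_ceil _
  rw [div_le_iff₀ (by positivity)] at h3
  rw [div_le_div_iff₀ (by positivity) (by positivity)]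
  have h4 : (sampleSize n c ε δ : ℝ) * (tolerance n c ε ^ 2 * (δ / L)) * L =
      sampleSize n c ε δ * tolerance n c ε ^ 2 * δ := by field_simp
  have h5 := mul_le_mul_of_nonneg_right h3 hL0.le
  rw [h4] at h5
  linarith

theorem clog_le (hn : 2 ≤ n) (hc : 3 ≤ c) :
    (Nat.clog 2 ⌊searchBound n c⌋₊ : ℝ) ≤ Real.logb 2 (searchBound n c) + 1 := by
  have h2 := one_le_logb_searchBound hn hc
  have hK := two_le_searchBound hn hc
  have hK2 : 2 ≤ ⌊searchBound n c⌋₊ := Nat.le_floor (by exact_mod_cast hK)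
  have hlt := Nat.pow_pred_clog_lt_self (b := 2) (by norm_num) (show 1 < ⌊searchBound n c⌋₊ by omega)
  have hpos : 0 < Nat.clog 2 ⌊searchBound n c⌋₊ := Nat.clog_pos (by norm_num) hK2
  obtain ⟨J, hJ⟩ := Nat.exists_eq_succ_of_ne_zero hpos.ne'
  rw [hJ, Nat.pred_succ] at hlt
  rw [hJ]
  push_cast
  have h3 : (2 : ℝ) ^ J ≤ searchBound n c :=
    le_trans (by exact_mod_cast hlt.le) (Nat.floor_le (by linarith))
  have : (J : ℝ) ≤ Real.logb 2 (searchBound n c) := by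
    rw [Real.le_logb_iff_rpow_le (by norm_num) (by linarith), Real.rpow_natCast]
    exact h3
  linarith

theorem threshold_lt (hn : 2 ≤ n) (hc : 3 ≤ c) : threshold n c < 1 - 1 / (n : ℝ) := by
  have hn' : (2 : ℝ) ≤ n := by exact_mod_cast hn
  unfold threshold
  have h1 : (4 : ℝ) ≤ (n : ℝ) ^ c := by
    calc (4 : ℝ) = 2 ^ (2 : ℝ) := by norm_num
      _ ≤ (n : ℝ) ^ (2 : ℝ) := by gcongr
      _ ≤ (n : ℝ) ^ c := Real.rpow_le_rpow_of_exponent_le (by linarith) (by linarith)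
  have h2 : 1 / (n : ℝ) ^ c ≤ 1 / 4 := by gcongr
  have h3 : 1 / (n : ℝ) ≤ 1 / 2 := by gcongr
  linarith

theorem tolerance_le (hn : 2 ≤ n) (hε1 : ε < 1) : tolerance n c ε ≤ 1 / 8 * threshold n c := by
  have hn' : (0 : ℝ) < n := by exact_mod_cast (by omega : 0 < n)
  have : 0 < (n : ℝ) ^ c := by positivity
  unfold tolerance threshold
  rw [div_mul_div_comm, mul_one]
  gcongr

/-- From τ ≥ 1/n² and ⌊K₀⌋ ≥ K₀ - 1 the power is at most e^(1/4) n^(-c-1), and the spare 1/n ≤ 1/2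
outweighs e^(1/4) ≤ 4/3. The remaining θ/8 leaves room for the sampling error. -/
theorem exp_searchBound_le (hn : 2 ≤ n) (hc : 3 ≤ c) {τ : ℝ} (hτ : 1 ≤ (n : ℝ) ^ 2 * τ)
    (hτ1 : τ ≤ 1) : (1 - τ) ^ ⌊searchBound n c⌋₊ ≤ 7 / 8 * threshold n c := by
  have hn' : (2 : ℝ) ≤ n := by exact_mod_cast hn
  have hn0 : (0 : ℝ) < n := by linarith
  set K := ⌊searchBound n c⌋₊
  have hK : searchBound n c - 1 ≤ K := (Nat.sub_one_lt_floor _).le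
  have h1 : (1 - τ) ^ K ≤ Real.exp (-(τ * K)) := by
    have := Real.add_one_le_exp (-τ)
    calc (1 - τ) ^ K ≤ Real.exp (-τ) ^ K := pow_le_pow_left₀ (by linarith) (by linarith) K
      _ = Real.exp (-(τ * K)) := by rw [← Real.exp_nat_mul]; ring_nf
  have h2 : 1 / (n : ℝ) ^ 2 ≤ τ := by rwa [div_le_iff₀' (by positivity)]
  have h3 : (c + 1) * Real.log n - 1 / 4 ≤ τ * K := by
    have e1 : 1 / (n : ℝ) ^ 2 * (searchBound n c - 1) =
        (c + 1) * Real.log n - 1 / (n : ℝ) ^ 2 := by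
      unfold searchBound; field_simp
    have e2 : 1 / (n : ℝ) ^ 2 ≤ 1 / 2 ^ 2 := by gcongr
    have e3 : 1 / (n : ℝ) ^ 2 * (searchBound n c - 1) ≤ τ * K := by
      have := two_le_searchBound hn hc
      have : 0 < 1 / (n : ℝ) ^ 2 := by positivity
      exact mul_le_mul h2 hK (by linarith) (by linarith)
    linarith
  have h4 : Real.exp (1 / 4) ≤ 4 / 3 := by
    have e1 := Real.add_one_le_exp (-(1 / 4) : ℝ)
    have e2 : Real.exp (1 / 4) * Real.exp (-(1 / 4)) = 1 := by rw [← Real.exp_add]; simp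
    have := Real.exp_pos (1 / 4)
    nlinarith
  calc (1 - τ) ^ K ≤ Real.exp (-(τ * K)) := h1
    _ ≤ Real.exp (1 / 4 + Real.log n * (-(c + 1))) := Real.exp_le_exp.2 (by linarith)
    _ = Real.exp (1 / 4) * (1 / (n : ℝ) * threshold n c) := by
        rw [Real.exp_add, ← Real.rpow_def_of_pos hn0, threshold, Real.rpow_neg hn0.le,
          Real.rpow_add hn0, Real.rpow_one]
        field_simp
    _ ≤ 4 / 3 * (1 / 2 * threshold n c) := by
        have : 0 ≤ threshold n c := by unfold threshold; positivity
        gcongr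
    _ ≤ 7 / 8 * threshold n c := by
        have : 0 ≤ threshold n c := by unfold threshold; positivity
        linarith

/-- 64 is the square of the 8 in `tolerance`; the 65th unit covers rounding up, as the quantity it
multiplies is at least 1. -/
theorem sampleSize_le (hn : 2 ≤ n) (hc : 3 ≤ c) (hε : 0 < ε) (hε1 : ε < 1) (hδ : 0 < δ)
    (hδ1 : δ < 1) : (sampleSize n c ε δ : ℝ) ≤
      65 * (n : ℝ) ^ (2 * c) * Real.logb 2 (searchBound n c) / (ε ^ 2 * δ) := by
  have hn' : (2 : ℝ) ≤ n := by exact_mod_cast hn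
  have hn0 : (0 : ℝ) < n := by linarith
  have hL := one_le_logb_searchBound hn hc
  set L := Real.logb 2 (searchBound n c) with hLdef
  have hL0 : 0 < L := by linarith
  have hpow : (n : ℝ) ^ (2 * c) = ((n : ℝ) ^ c) ^ 2 := by
    rw [← Real.rpow_natCast, ← Real.rpow_mul hn0.le, mul_comm]; norm_num
  have hx : 1 / (tolerance n c ε ^ 2 * (δ / L)) = 64 * (n : ℝ) ^ (2 * c) * L / (ε ^ 2 * δ) := by
    have : (n : ℝ) ^ c ≠ 0 := by positivity
    rw [hpow]
    unfold tolerance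
    field_simp
    norm_num
  have h1 : (sampleSize n c ε δ : ℝ) ≤ 64 * (n : ℝ) ^ (2 * c) * L / (ε ^ 2 * δ) + 1 := by
    unfold sampleSize
    rw [← hx]
    exact (Nat.ceil_lt_add_one (by positivity)).le
  have h2 : 1 ≤ (n : ℝ) ^ (2 * c) * L / (ε ^ 2 * δ) := by
    rw [one_le_div (by positivity)]
    have e1 : ε ^ 2 * δ ≤ 1 := by
      have := pow_le_one₀ (n := 2) hε.le hε1.le
      exact mul_le_one₀ this hδ.le hδ1.le
    have e2 : 1 ≤ (n : ℝ) ^ (2 * c) := Real.one_le_rpow (by linarith) (by linarith)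
    nlinarith
  calc (sampleSize n c ε δ : ℝ) ≤ 64 * (n : ℝ) ^ (2 * c) * L / (ε ^ 2 * δ) +
        (n : ℝ) ^ (2 * c) * L / (ε ^ 2 * δ) := by linarith
    _ = _ := by ring

/-- Each of the three logarithms is bounded by a multiple of the cube root of n, so together they
cost one factor n. -/
theorem logb_sq_mul_log_le (hn : 2 ≤ n) (hc : 3 ≤ c) :
    Real.logb 2 (searchBound n c) ^ 2 * Real.log n ≤ 12 * (c + 10) ^ 2 * n := by
  have hn' : (2 : ℝ) ≤ n := by exact_mod_cast hn
  have hn0 : (0 : ℝ) < n := by linarith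
  have hL := one_le_logb_searchBound hn hc
  set y := (n : ℝ) ^ (1 / 3 : ℝ) with hy
  have hy0 : 0 < y := by positivity
  have hy3 : y ^ 3 = n := by
    rw [hy, ← Real.rpow_natCast, ← Real.rpow_mul hn0.le]; norm_num
  have hy1 : 1 ≤ y := Real.one_le_rpow (by linarith) (by norm_num)
  have hlogn : Real.log n ≤ 3 * y := by
    have := Real.log_le_rpow_div hn0.le (show (0 : ℝ) < 1 / 3 by norm_num)
    linarith
  have hlogn0 : 0 < Real.log n := Real.log_pos (by linarith)
  have hlogK : Real.log (searchBound n c) ≤ (c + 10) * y := by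
    unfold searchBound
    rw [Real.log_mul (by positivity) hlogn0.ne', Real.log_mul (by positivity) (by positivity),
      Real.log_pow]
    have e1 : Real.log (c + 1) ≤ c := by
      have := Real.log_le_sub_one_of_pos (show 0 < c + 1 by linarith); linarith
    have e2 : Real.log (Real.log n) ≤ Real.log n := by
      have := Real.log_le_sub_one_of_pos hlogn0; linarith
    push_cast
    nlinarith
  have hLle : Real.logb 2 (searchBound n c) ≤ 2 * ((c + 10) * y) := by
    rw [Real.logb, div_le_iff₀ (Real.log_pos (by norm_num))]
    have : (1 : ℝ) / 2 ≤ Real.log 2 := by linarith [Real.log_two_gt_d9]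
    have h2 : 0 ≤ 2 * ((c + 10) * y) := by positivity
    nlinarith
  calc Real.logb 2 (searchBound n c) ^ 2 * Real.log n
      ≤ (2 * ((c + 10) * y)) ^ 2 * (3 * y) := by gcongr
    _ = 12 * (c + 10) ^ 2 * y ^ 3 := by ring
    _ = _ := by rw [hy3]

/-- Here 2340 = 3 · 65 · 12, with at most 3L units from the halvings. Writing |c| keeps the constant
positive for every real c, since it is chosen before c ≥ 3 is known. -/
theorem used_bound (hn : 2 ≤ n) (hc : 3 ≤ c) (hε : 0 < ε) (hε1 : ε < 1) (hδ : 0 < δ)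
    (hδ1 : δ < 1) :
    (((Nat.clog 2 ⌊searchBound n c⌋₊ + 1) *
      (sampleSize n c ε δ * ⌊searchBound n c⌋₊) : ℕ) : ℝ) ≤
      2340 * (|c| + 10) ^ 3 * (n : ℝ) ^ (2 * c + 3) / (ε ^ 2 * δ) := by
  have hn' : (2 : ℝ) ≤ n := by exact_mod_cast hn
  have hn0 : (0 : ℝ) < n := by linarith
  have hL := one_le_logb_searchBound hn hc
  have hJ := clog_le hn hc
  have hN := sampleSize_le hn hc hε hε1 hδ hδ1
  have hB := two_le_searchBound hn hc
  have hK : (⌊searchBound n c⌋₊ : ℝ) ≤ searchBound n c := Nat.floor_le (by linarith)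
  have hLL := logb_sq_mul_log_le hn hc
  set L := Real.logb 2 (searchBound n c) with hLdef
  have hL0 : 0 < L := by linarith
  have hlog : 0 < Real.log n := Real.log_pos (by linarith)
  push_cast
  calc ((Nat.clog 2 ⌊searchBound n c⌋₊ : ℝ) + 1) *
        ((sampleSize n c ε δ : ℝ) * (⌊searchBound n c⌋₊ : ℝ))
      ≤ (3 * L) * ((65 * (n : ℝ) ^ (2 * c) * L / (ε ^ 2 * δ)) * searchBound n c) := by
        gcongr
        linarith
    _ = 195 * (c + 1) * (L ^ 2 * Real.log n) * (n : ℝ) ^ (2 * c) * (n : ℝ) ^ 2 / (ε ^ 2 * δ) := by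
        unfold searchBound; ring
    _ ≤ 195 * (c + 10) * (12 * (c + 10) ^ 2 * n) * (n : ℝ) ^ (2 * c) * (n : ℝ) ^ 2 /
          (ε ^ 2 * δ) := by
        gcongr
        norm_num
    _ = 2340 * (c + 10) ^ 3 * ((n : ℝ) ^ (2 * c) * (n : ℝ) ^ 3) / (ε ^ 2 * δ) := by ring
    _ = 2340 * (|c| + 10) ^ 3 * (n : ℝ) ^ (2 * c + 3) / (ε ^ 2 * δ) := by
        rw [abs_of_nonneg (by linarith), Real.rpow_add hn0]
        norm_cast

end parameters

/-! ### The search succeeds with high probability -/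

section main

variable {V : Type*} [Fintype V] [DecidableEq V] {G : SimpleGraph V} [DecidableRel G.Adj] {r : V}

/-- What is claimed of the final state of the search. -/
def Successful (G : SimpleGraph V) [DecidableRel G.Adj] (r : V) (c ε : ℝ) (s : SearchState) :
    Prop :=
  s.lo + 1 = s.hi ∧ (s.hi : ℝ) ≤ searchBound (Fintype.card V) c ∧
    s.Qhi ≤ threshold (Fintype.card V) c ∧ threshold (Fintype.card V) c < s.Qlo ∧
    |excess G r s.hi - s.Qhi| < tolerance (Fintype.card V) c ε ∧
    |excess G r s.lo - s.Qlo| < tolerance (Fintype.card V) c ε ∧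
    (1 - ε) * spectralGap G ≤ s.gapEstimate ∧ s.gapEstimate ≤ (1 + ε) * spectralGap G

/-- The deterministic half: Q₀ is exact and q is at most 7θ/8 at ⌊K₀⌋, so the initial interval
straddles the threshold and the invariant survives every halving. -/
theorem successful_of_good_estimates (hG : G.Connected) (hT : NodeTransitive G)
    (hn : 2 ≤ Fintype.card V) {c ε δ : ℝ} (hc3 : 3 ≤ c) (hε : 0 < ε) (hε1 : ε < 1) (hδ : 0 < δ)
    (hc : 1 + 2 / ε ≤ c) {T : ℕ → ℕ} (hmono : StrictMono T)
    (hinit : |excess G r ⌊searchBound (Fintype.card V) c⌋₊ -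
      estimate (Fintype.card V) (sampleSize (Fintype.card V) c ε δ) T
        ⌊searchBound (Fintype.card V) c⌋₊ 0| < tolerance (Fintype.card V) c ε)
    (hstep : ∀ j < Nat.clog 2 ⌊searchBound (Fintype.card V) c⌋₊,
      ∀ s, s = searchAt (Fintype.card V) c ε δ T j → s.lo + 1 < s.hi →
      |excess G r ((s.lo + s.hi) / 2) - estimate (Fintype.card V)
        (sampleSize (Fintype.card V) c ε δ) T ((s.lo + s.hi) / 2) s.used| <
          tolerance (Fintype.card V) c ε) :
    Successful G r c ε (binarySearch (Fintype.card V) c ε δ T) := by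
  obtain ⟨S, e, hcard, hq, he, hex, hgap⟩ := excess_spectral hG hT (by omega) r
  have hq1 := excess_one (G := G) r
  have hq0 := excess_zero (G := G) r
  set n := Fintype.card V
  have hN := sampleSize_pos hn hc3 hε hδ
  have hη := tolerance_pos (c := c) hn hε
  have hB := two_le_searchBound hn hc3
  have hQlo : (searchInit n c ε δ T).Qlo = 1 - 1 / (n : ℝ) := estimate_zero hmono hN 0
  have hQhi : (searchInit n c ε δ T).Qhi =
      estimate n (sampleSize n c ε δ) T ⌊searchBound n c⌋₊ 0 := by
    simp only [searchInit, experimentIndex_zero hmono]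
  have hn0 : (0 : ℝ) < n := by exact_mod_cast (by omega : 0 < n)
  have hτ1 : spectralGap G ≤ 1 := by
    obtain ⟨i, hi, h⟩ := hex
    have := (he i hi).1
    linarith
  have hqK : excess G r ⌊searchBound n c⌋₊ ≤ 7 / 8 * threshold n c := by
    refine le_trans ?_ (exp_searchBound_le hn hc3 hgap hτ1)
    have h1 := excess_le_pow hcard hq he ⌊searchBound n c⌋₊
    have h2 : 0 ≤ (1 - spectralGap G) ^ ⌊searchBound n c⌋₊ := pow_nonneg (by linarith) _
    refine le_of_mul_le_mul_left (a := (n : ℝ)) ?_ hn0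
    linarith
  have hinv := searchAt_invariant (n := n) (c := c) (ε := ε) (δ := δ) (T := T)
    (q := excess G r) (η := tolerance n c ε) (J := Nat.clog 2 ⌊searchBound n c⌋₊) (e := 0)
    (Nat.le_floor (by push_cast; linarith))
    (by rw [hQlo]; exact threshold_lt hn hc3)
    (by rw [hQlo, hq0, sub_self, abs_zero]; exact hη)
    (by
      rw [hQhi]
      have h1 := (abs_lt.1 hinit).1
      have h2 := tolerance_le (c := c) hn hε1
      linarith)
    (by rw [hQhi]; exact hinit)
    (fun j hj hlt => hstep j hj _ rfl hlt)
    (Nat.le_pow_clog (by norm_num) _) _ rfl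
  have hbd := (searchAt_bounds n c ε δ T (Nat.clog 2 ⌊searchBound n c⌋₊)).2
  change Successful G r c ε (searchAt n c ε δ T (Nat.clog 2 ⌊searchBound n c⌋₊))
  set s := searchAt n c ε δ T (Nat.clog 2 ⌊searchBound n c⌋₊)
  obtain ⟨h1, h2, h3, h4, h5, h6⟩ := hinv
  have hhi : s.lo + 1 = s.hi := le_antisymm h1 (by simpa using h2)
  rw [← hhi] at h5
  have hacc := gap_accuracy hn hcard hq he hex hq1 hε hε1 hc h3 h4 h5 h6
  rw [hhi] at hacc h5
  exact ⟨hhi, (Nat.cast_le.2 hbd).trans (Nat.floor_le (by linarith)), h3, h4, h5, h6, hacc⟩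

/-- Union bound: with L = log₂ K₀ there are at most 4L estimates that can fail, each with
probability at most δ/(4L). -/
theorem IsLazyWalk.measureReal_not_successful [MeasurableSpace V] [MeasurableSingletonClass V]
    {P : Measure (ℕ → V)} [IsProbabilityMeasure P] (hP : IsLazyWalk G r P fun t x => x t)
    (hR : ∀ᵐ x ∂P, Recurrent r x) (hG : G.Connected) (hT : NodeTransitive G)
    (hn : 2 ≤ Fintype.card V) {c ε δ : ℝ} (hc3 : 3 ≤ c) (hε : 0 < ε) (hε1 : ε < 1) (hδ : 0 < δ)
    (hc : 1 + 2 / ε ≤ c) :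
    P.real {x | ¬ Successful G r c ε (binarySearch (Fintype.card V) c ε δ (returns r x))} ≤ δ := by
  have hN := sampleSize_pos hn hc3 hε hδ
  have hη := tolerance_pos (c := c) hn hε
  have hL := one_le_logb_searchBound hn hc3
  have hJ := clog_le hn hc3
  have hfail := failure_le hn hc3 hε hδ
  set n := Fintype.card V
  set η := tolerance n c ε
  set N := sampleSize n c ε δ
  set K := ⌊searchBound n c⌋₊
  set J := Nat.clog 2 K
  set bad₀ : Set (ℕ → V) := {x | η ≤ |excess G r K - estimate n N (returns r x) K 0|} with hbad₀
  set bad : ℕ → Set (ℕ → V) := fun j => {x | ∃ s, s = searchAt n c ε δ (returns r x) j ∧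
    s.lo + 1 < s.hi ∧ η ≤ |excess G r ((s.lo + s.hi) / 2) -
      estimate n N (returns r x) ((s.lo + s.hi) / 2) s.used|} with hbad
  have hsub : {x | ¬ Successful G r c ε (binarySearch n c ε δ (returns r x))} ≤ᵐ[P]
      (bad₀ ∪ ⋃ j ∈ Finset.range J, bad j : Set (ℕ → V)) := by
    filter_upwards [hR] with x hx hns
    by_contra hnb
    have hnb' : x ∉ bad₀ ∧ ∀ j < J, x ∉ bad j := by
      refine ⟨fun h => hnb (Or.inl h), fun j hj h => hnb (Or.inr ?_)⟩
      exact Set.mem_iUnion₂.2 ⟨j, Finset.mem_range.2 hj, h⟩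
    refine hns (successful_of_good_estimates hG hT hn hc3 hε hε1 hδ hc hx.strictMono
      (not_le.1 hnb'.1) fun j hj s hs hlt => ?_)
    by_contra h
    exact hnb'.2 j hj ⟨s, hs, hlt, not_lt.1 h⟩
  have hle : P.real {x | ¬ Successful G r c ε (binarySearch n c ε δ (returns r x))} ≤
      P.real (bad₀ ∪ ⋃ j ∈ Finset.range J, bad j) :=
    ENNReal.toReal_mono (measure_ne_top _ _) (measure_mono_ae hsub)
  have h0 : P.real bad₀ ≤ 1 / (4 * N * η ^ 2) := hP.measureReal_estimate hR K hN hη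
  have h1 : ∀ j, P.real (bad j) ≤ 1 / (4 * N * η ^ 2) :=
    hP.measureReal_searchAt hR c ε δ hN hη
  calc P.real {x | ¬ Successful G r c ε (binarySearch n c ε δ (returns r x))}
      ≤ P.real bad₀ + ∑ j ∈ Finset.range J, P.real (bad j) :=
        hle.trans ((measureReal_union_le _ _).trans
          (add_le_add le_rfl (measureReal_biUnion_finset_le _ _)))
    _ ≤ 1 / (4 * N * η ^ 2) + ∑ _j ∈ Finset.range J, 1 / (4 * N * η ^ 2) := by
        gcongr with j
        exact h1 j
    _ = (J + 1) * (1 / (4 * N * η ^ 2)) := by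
        rw [Finset.sum_const, Finset.card_range, nsmul_eq_mul]; ring
    _ ≤ (4 * Real.logb 2 (searchBound n c)) * (δ / (4 * Real.logb 2 (searchBound n c))) := by
        gcongr
        linarith
    _ = δ := by
        have : Real.logb 2 (searchBound n c) ≠ 0 := by linarith
        field_simp

/-- The law of a lazy walk on the space of paths. -/
theorem IsLazyWalk.map_path [MeasurableSpace V] [MeasurableSingletonClass V] {Ω : Type*}
    [MeasurableSpace Ω] {μ : Measure Ω} {w : ℕ → Ω → V} (hw : IsLazyWalk G r μ w) :
    Measurable (fun ω t => w t ω) ∧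
      IsLazyWalk G r (μ.map fun ω t => w t ω) fun t (x : ℕ → V) => x t := by
  have hmeas : Measurable (fun ω t => w t ω) :=
    measurable_pi_iff.2 fun t => measurable_to_countable' fun v => hw.measurableSet_eq t v
  refine ⟨hmeas, fun t v => measurableSet_coord t v, fun t x => ?_⟩
  have hc : MeasurableSet (pathCylinder x t) :=
    DeterminedAt.measurableSet (t := t) fun y z h hy s hs => (h s hs).symm.trans (hy s hs)
  rw [← hw.law t x]
  exact map_measureReal_apply hmeas hc

end main

end BatWalk

/-! ### The theorem -/

open BatWalk in
theorem mainTheorem1 (c : ℝ) :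
    ∃ C : ℝ, 0 < C ∧
      ∀ (V : Type*) [Fintype V] [DecidableEq V] (G : SimpleGraph V) [DecidableRel G.Adj]
        (r : V) (Ω : Type*) [MeasurableSpace Ω] (μ : MeasureTheory.Measure Ω)
        [MeasureTheory.IsProbabilityMeasure μ] (w : ℕ → Ω → V) (ε δ : ℝ),
        G.Connected → BatWalk.NodeTransitive G → 1 < Fintype.card V →
        BatWalk.IsLazyWalk G r μ w →
        0 < ε → ε < 1 → 0 < δ → δ < 1 → 1 + 2 / ε ≤ c →
        -- the walk returns infinitely often, and `n` is the expected first return time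
        ((∀ᵐ ω ∂μ, {t : ℕ | w t ω = r}.Infinite) ∧
          MeasureTheory.Integrable (fun ω => (BatWalk.returnTime w r ω 1 : ℝ)) μ ∧
          ∫ ω, (BatWalk.returnTime w r ω 1 : ℝ) ∂μ = (Fintype.card V : ℝ)) ∧
        -- with probability at least `1 - δ` the search finds `k` as required, and
        -- `1 - Q_k^{1/k}` is within a factor `1 ± ε` of the spectral gap
        (1 - δ ≤ μ.real {ω |
          let s := BatWalk.binarySearch (Fintype.card V) c ε δ (BatWalk.returnTime w r ω)
          s.lo + 1 = s.hi ∧ (s.hi : ℝ) ≤ BatWalk.searchBound (Fintype.card V) c ∧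
          s.Qhi ≤ BatWalk.threshold (Fintype.card V) c ∧
          BatWalk.threshold (Fintype.card V) c < s.Qlo ∧
          |BatWalk.excess G r s.hi - s.Qhi| < BatWalk.tolerance (Fintype.card V) c ε ∧
          |BatWalk.excess G r s.lo - s.Qlo| < BatWalk.tolerance (Fintype.card V) c ε ∧
          (1 - ε) * BatWalk.spectralGap G ≤ s.gapEstimate ∧
          s.gapEstimate ≤ (1 + ε) * BatWalk.spectralGap G}) ∧
        -- almost surely the search depends only on the returns that it has observed, and their
        -- number is polynomial in `n`, `1/ε` and `1/δ`
        (∀ᵐ ω ∂μ,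
          (∀ T : ℕ → ℕ,
            (∀ i ≤ (BatWalk.binarySearch (Fintype.card V) c ε δ
                (BatWalk.returnTime w r ω)).used, T i = BatWalk.returnTime w r ω i) →
              BatWalk.binarySearch (Fintype.card V) c ε δ T =
                BatWalk.binarySearch (Fintype.card V) c ε δ (BatWalk.returnTime w r ω)) ∧
          ((BatWalk.binarySearch (Fintype.card V) c ε δ (BatWalk.returnTime w r ω)).used : ℝ) ≤
            C * (Fintype.card V : ℝ) ^ (2 * c + 3) / (ε ^ 2 * δ)) := by
  refine ⟨2340 * (|c| + 10) ^ 3, by positivity, ?_⟩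
  intro V _ _ G _ r Ω _ μ _ w ε δ hG hT hn hw hε hε1 hδ hδ1 hc
  let _ : MeasurableSpace V := ⊤
  have hn2 : 2 ≤ Fintype.card V := hn
  have hc3 : 3 ≤ c := by
    have : 2 ≤ 2 / ε := by rw [le_div_iff₀ hε]; linarith
    linarith
  have hd : ∀ x, G.degree x = G.degree r := fun x => hT.degree_eq x r
  have hd0 : 0 < G.degree r := by
    have : Nontrivial V := Fintype.one_lt_card_iff_nontrivial.1 hn
    exact hG.preconnected.degree_pos_of_nontrivial r
  obtain ⟨hmeas, hP⟩ := hw.map_path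
  set W : Ω → ℕ → V := fun ω t => w t ω
  have : IsProbabilityMeasure (μ.map W) := Measure.isProbabilityMeasure_map hmeas.aemeasurable
  have hR := hP.ae_recurrent hG hd hd0
  have hRμ : ∀ᵐ ω ∂μ, Recurrent r (W ω) := ae_of_ae_map hmeas.aemeasurable hR
  obtain ⟨hmT, hint⟩ := hP.lintegral_returns_one hG hd hd0
  have hmT' : AEMeasurable (fun ω => (returns r (W ω) 1 : ENNReal)) μ := hmT.comp_measurable hmeas
  have hint' : ∫⁻ ω, (returns r (W ω) 1 : ENNReal) ∂μ = Fintype.card V := by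
    rw [← hint, lintegral_map' hmT hmeas.aemeasurable]
  refine ⟨⟨?_, ?_, ?_⟩, ?_, ?_⟩
  · filter_upwards [hRμ] with ω hω
    exact hω.2
  · have := integrable_toReal_of_lintegral_ne_top hmT' (by rw [hint']; simp)
    simp only [ENNReal.toReal_natCast] at this
    exact this
  · have := integral_toReal hmT' (by simp)
    rw [hint'] at this
    simp only [ENNReal.toReal_natCast] at this
    exact this
  · have hfail : μ.real {ω | ¬ Successful G r c ε
        (binarySearch (Fintype.card V) c ε δ (returns r (W ω)))} ≤ δ := by
      refine le_trans ?_ (hP.measureReal_not_successful hR hG hT hn2 hc3 hε hε1 hδ hc)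
      exact ENNReal.toReal_mono (measure_ne_top _ _)
        (Measure.le_map_apply hmeas.aemeasurable _)
    -- No measurability of the success event is needed: subadditivity bounds its measure below by 1
    -- minus that of its complement.
    have hunion := measureReal_union_le (μ := μ)
      {ω | Successful G r c ε (binarySearch (Fintype.card V) c ε δ (returns r (W ω)))}
      {ω | ¬ Successful G r c ε (binarySearch (Fintype.card V) c ε δ (returns r (W ω)))}
    have huniv : {ω | Successful G r c ε
          (binarySearch (Fintype.card V) c ε δ (returns r (W ω)))} ∪
        {ω | ¬ Successful G r c ε
          (binarySearch (Fintype.card V) c ε δ (returns r (W ω)))} = Set.univ :=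
      Set.union_compl_self _
    rw [huniv, probReal_univ] at hunion
    have h1 : 1 - δ ≤ μ.real {ω | Successful G r c ε
        (binarySearch (Fintype.card V) c ε δ (returns r (W ω)))} := by linarith
    exact h1
  · filter_upwards [hRμ] with ω hω
    refine ⟨fun T hTag => searchAt_congr _ c ε δ hω.strictMono _ hTag, ?_⟩
    exact (Nat.cast_le.2 (used_searchAt_le _ c ε δ hω.strictMono _)).trans
      (used_bound hn2 hc3 hε hε1 hδ hδ1)
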